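/- Let $(T(t))_{t\ge 0}$ be an immediately differentiable $C_0$-semigroup (all orbits $t\mapsto T(t)x$ are differentiable on $(0,\infty)$) on a complex Banach space $X$ with generator $A$, and let $X_1$ be $\operatorname{dom}(A)$ with the graph norm. Let $V$ be a Banach space that embeds continuously into $X$ and such that $V$ is separable or the closed unit ball of $V$ is closed in $X$. Let $B(\kappa)\in\mathcal L(X_1,X)$ for $\kappa\in\mathbb C$, $|\kappa|<1$, with $B(0)=0$, and put $A(\kappa):=A+B(\kappa)$ with domain $\operatorname{dom}(A)$. Assume that $\kappa\mapsto A(\kappa)x\in X$ is holomorphic on $\{|\kappa|<1\}$ for each $x\in\operatorname{dom}(A)$, and that for each $\kappa$ the operator $B=B(\kappa)$ satisfies the following three conditions, in which the constants may depend on $\kappa$. (S1) There are $C\ge 1$ and $\alpha>0$ with $T(t)X\subseteq V$ and $\|T(t)\|_{X\to V}\le Ct^{-\alpha}$ for all $t\in(0,1]$. (S2) There are $q\in(0,1)$ and $t_0>0$ with $\int_0^{t_0}\|BT(s)x\|_X\,ds\le q\|x\|_X$ for all $x\in\operatorname{dom}(A)$. (S3) There are $C\ge 1$ and $\beta\in[0,1)$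 such that for all $t\in(0,1]$ one has $\|T(t)\|_{V\to V}\le C$, and such that $BT(t)x\in V$ and $\|BT(t)x\|_V\le Ct^{-\beta}\|x\|_V$ for all $x\in V$ with $T(t)x\in\operatorname{dom}(B)$. Let $\lambda_0\in\sigma(A)$ be a pole of the resolvent $R(\cdot,A)$ and an algebraically simple eigenvalue of $A$ (i.e. $\dim\bigcup_{m}\ker(\lambda_0-A)^m=1$), and let $r>0$ satisfy $\{\lambda:|\lambda-\lambda_0|\le r\}\cap\sigma(A)=\{\lambda_0\}$. Suppose that $$\sup_{|\lambda-\lambda_0|=r}\|B(\kappa)R(\lambda,A)\|_{\mathcal L(X)}\longrightarrow 0\qquad\text{as }\kappa\to 0 .$$ Then there is $\delta\in(0,1]$ such that for every $\kappa$ with $|\kappa|<\delta$ the operator $A(\kappa)$ has exactly one spectral value $\lambda(\kappa)$ in $\{\lambda:|\lambda-\lambda_0|<r\}$; this $\lambda(\kappa)$ is a pole of $R(\cdot,A(\kappa))$ and an algebraically simple eigenvalue of $A(\kappa)$, and the corresponding spectral projection $P(\kappa)$ has range contained in $V$ and restricts to a bounded operator on $V$. Moreover, on $\{|\kappa|<\delta\}$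 the map $\kappa\mapsto\lambda(\kappa)\in\mathbb C$ is analytic, and the map $\kappa\mapsto P(\kappa)$ is analytic both into $\mathcal L(X)$ and into $\mathcal L(V)$. -/

import Mathlib

open Filter Topology Set Metric

namespace AnalyticPerturbation

/-! ### Unbounded operators: resolvent, spectrum, poles, generalised eigenspaces

An operator `A : dom(A) ⊆ X → X` is a `LinearPMap`, written `X →ₗ.[ℂ] X`. The sum `A + B` is the
sum of partial linear maps, with domain `dom(A) ∩ dom(B)`. -/

section Operators

variable {X : Type*} [NormedAddCommGroup X] [NormedSpace ℂ X]

open Classical in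
/-- The value `A x` for `x ∈ dom(A)`, and `0` elsewhere. -/
noncomputable def val (A : X →ₗ.[ℂ] X) (x : X) : X :=
  if h : x ∈ A.domain then A ⟨x, h⟩ else 0

/-- The bounded operator `R` on `X` is a two-sided inverse of `z - A : dom(A) → X`. -/
def IsResolventAt (A : X →ₗ.[ℂ] X) (z : ℂ) (R : X →L[ℂ] X) : Prop :=
  (∀ y : X, ∃ h : R y ∈ A.domain, z • R y - A ⟨R y, h⟩ = y) ∧
    ∀ x : A.domain, R (z • (x : X) - A x) = x

/-- The resolvent set `ρ(A)`. -/
def resolventSet (A : X →ₗ.[ℂ] X) : Set ℂ :=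
  {z | ∃ R : X →L[ℂ] X, IsResolventAt A z R}

/-- The spectrum `σ(A) = ℂ ∖ ρ(A)`. -/
def spec (A : X →ₗ.[ℂ] X) : Set ℂ := (resolventSet A)ᶜ

open Classical in
/-- The resolvent `R(z, A) = (z - A)⁻¹` for `z ∈ ρ(A)`, and `0` for `z ∈ σ(A)`. -/
noncomputable def resolvent (A : X →ₗ.[ℂ] X) (z : ℂ) : X →L[ℂ] X :=
  if h : z ∈ resolventSet A then h.choose else 0

/-- `μ` is a spectral value of `A`, isolated in `σ(A)`, and the analytic map `z ↦ R(z, A)` has a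
pole at `μ`. -/
def IsResolventPole (A : X →ₗ.[ℂ] X) (μ : ℂ) : Prop :=
  μ ∈ spec A ∧ (∀ᶠ z in 𝓝[≠] μ, z ∈ resolventSet A) ∧
    MeromorphicAt (resolvent A) μ ∧ meromorphicOrderAt (resolvent A) μ < 0

/-- `ker (μ - A) ^ m`, where the powers carry their natural domains: `x ∈ ker (μ - A) ^ (m + 1)`
iff `x ∈ dom(A)` and `(μ - A) x ∈ ker (μ - A) ^ m`. -/
def kerPow (A : X →ₗ.[ℂ] X) (μ : ℂ) : ℕ → Submodule ℂ X
  | 0 => ⊥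
  | m + 1 => ((kerPow A μ m).comap (μ • A.domain.subtype - A.toFun)).map A.domain.subtype

/-- The generalised eigenspace `⋃ₘ ker (μ - A) ^ m` (the supremum of an increasing sequence of
subspaces). -/
def genEigenspace (A : X →ₗ.[ℂ] X) (μ : ℂ) : Submodule ℂ X := ⨆ m, kerPow A μ m

/-- `μ` is an algebraically simple eigenvalue of `A`. -/
def IsAlgSimple (A : X →ₗ.[ℂ] X) (μ : ℂ) : Prop :=
  Module.finrank ℂ (genEigenspace A μ) = 1

/-- `P` is the spectral projection of `A` associated with the isolated spectral value `μ`: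
`P = (2πi)⁻¹ ∮ R(z, A) dz` over a positively oriented circle around `μ` that, with its interior,
meets `σ(A)` in `μ` only. -/
def IsSpectralProjection (A : X →ₗ.[ℂ] X) (μ : ℂ) (P : X →L[ℂ] X) : Prop :=
  ∃ ε > 0, closedBall μ ε ∩ spec A = {μ} ∧
    P = (2 * (Real.pi : ℂ) * Complex.I)⁻¹ • ∮ z in C(μ, ε), resolvent A z

/-- `sup { ‖B R(z, A)‖ : |z - μ| = r } ∈ [0, ∞]`, with the operator norm as the supremum over the
closed unit ball of `X`. -/
noncomputable def relSup (A B : X →ₗ.[ℂ] X) (μ : ℂ) (r : ℝ) : ENNReal :=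
  ⨆ z ∈ sphere μ r, ⨆ x ∈ closedBall (0 : X) 1, ‖val B (resolvent A z x)‖ₑ

/-- `B` is defined exactly on `dom(A)` and is bounded from `dom(A)` with the graph norm to `X`. -/
def IsBoundedOnDomain (A B : X →ₗ.[ℂ] X) : Prop :=
  B.domain = A.domain ∧
    ∃ M : ℝ, ∀ (x : X) (hA : x ∈ A.domain) (hB : x ∈ B.domain),
      ‖B ⟨x, hB⟩‖ ≤ M * (‖x‖ + ‖A ⟨x, hA⟩‖)

end Operators

/-! ### Semigroups -/

section Semigroups

variable {X : Type*} [NormedAddCommGroup X] [NormedSpace ℂ X]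

/-- `(T(t))_{t ≥ 0}` is a `C₀`-semigroup on `X`; the values of `T` at negative times play no
role. -/
structure IsC0Semigroup (T : ℝ → X →L[ℂ] X) : Prop where
  map_zero : T 0 = 1
  map_add : ∀ s t, 0 ≤ s → 0 ≤ t → T (s + t) = T s * T t
  tendsto_zero : ∀ x, Tendsto (fun t => T t x) (𝓝[>] 0) (𝓝 x)

/-- `A` is the generator of `T`: `x ∈ dom(A)` and `A x = y` iff `(T(t) x - x) / t → y` as
`t ↓ 0`. -/
def IsGenerator (T : ℝ → X →L[ℂ] X) (A : X →ₗ.[ℂ] X) : Prop :=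
  ∀ x y : X, (x, y) ∈ A.graph ↔
    Tendsto (fun t : ℝ => t⁻¹ • (T t x - x)) (𝓝[>] 0) (𝓝 y)

/-- All orbits are differentiable on `(0, ∞)`. -/
def IsImmediatelyDifferentiable (T : ℝ → X →L[ℂ] X) : Prop :=
  ∀ x, DifferentiableOn ℝ (fun t => T t x) (Ioi 0)

end Semigroups

/-! ### The conditions (S1), (S2), (S3)

The continuous embedding of `V` into `X` is an injective bounded operator `ι : V → X`. -/

section Conditions

variable {X V : Type*} [NormedAddCommGroup X] [NormedSpace ℂ X]
  [NormedAddCommGroup V] [NormedSpace ℂ V]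

/-- (S1), ultracontractivity: `T(t) X ⊆ V` and `‖T(t)‖_{X → V} ≤ C t ^ (-α)` for `t ∈ (0, 1]`. -/
def CondS1 (ι : V →L[ℂ] X) (T : ℝ → X →L[ℂ] X) : Prop :=
  ∃ C α : ℝ, 1 ≤ C ∧ 0 < α ∧ ∀ t ∈ Ioc (0 : ℝ) 1, ∀ x : X,
    ∃ v : V, ι v = T t x ∧ ‖v‖ ≤ C * t ^ (-α) * ‖x‖

/-- (S2): `∫₀^{t₀} ‖B T(s) x‖ ds ≤ q ‖x‖` for `x ∈ dom(A)`. For `B` bounded on `dom(A)` with the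
graph norm the integrand is continuous on `[0, t₀]`, because `T` acts strongly continuously on
`dom(A)`. -/
def CondS2 (T : ℝ → X →L[ℂ] X) (A B : X →ₗ.[ℂ] X) : Prop :=
  ∃ q ∈ Ioo (0 : ℝ) 1, ∃ t₀ > 0, ∀ x ∈ A.domain,
    ∫ s in (0 : ℝ)..t₀, ‖val B (T s x)‖ ≤ q * ‖x‖

/-- (S3): `‖T(t)‖_{V → V} ≤ C`, and `B T(t) x ∈ V` with `‖B T(t) x‖_V ≤ C t ^ (-β) ‖x‖_V` whenever
`x ∈ V`, `t ∈ (0, 1]` and `T(t) x ∈ dom(B)`. -/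
def CondS3 (ι : V →L[ℂ] X) (T : ℝ → X →L[ℂ] X) (B : X →ₗ.[ℂ] X) : Prop :=
  ∃ C β : ℝ, 1 ≤ C ∧ β ∈ Ico (0 : ℝ) 1 ∧ ∀ t ∈ Ioc (0 : ℝ) 1, ∀ x : V,
    (∃ w : V, ι w = T t (ι x) ∧ ‖w‖ ≤ C * ‖x‖) ∧
    ∀ h : T t (ι x) ∈ B.domain,
      ∃ w : V, ι w = B ⟨T t (ι x), h⟩ ∧ ‖w‖ ≤ C * t ^ (-β) * ‖x‖

end Conditions

end AnalyticPerturbation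

namespace AnalyticPerturbation

/-! ### A Hartogs lemma for vector-valued holomorphic functions -/

section Hartogs

open MeasureTheory Real

variable {E : Type*} [NormedAddCommGroup E] [NormedSpace ℂ E]

/-! Fix z₀ ∈ ρ(A). Since B(κ) is bounded on dom(A), it factors as C(κ)(z₀ - A) with C(κ) = B(κ)R(z₀,
A) bounded on X. The family C is strongly holomorphic, hence norm holomorphic, and C(0) = 0, so
‖C(κ)‖ is small for small κ.

Algebraic simplicity gives R(z, A) = (z - λ₀)⁻¹ φ(·)e + H(z) with H analytic on the closed disc
(`exists_isSimplePoleDecomposition`). A Lyapunov–Schmidt reduction then treats A + B for small C.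
With M(z) = (1 - BH(z))⁻¹, w(z) = M(z)Be, u(z) = e + H(z)w(z) and D(z) = z - λ₀ - φ(w(z)), the
resolvent is HM + D⁻¹ φ(M·)u (`isResolventAt_perturbed`). The spectrum in the disc is therefore the
zero set of D. The equation D = 0 is the contractive fixed point problem λ = λ₀ + φ(w(λ)), whose
iterates are holomorphic in κ and converge uniformly (`exists_differentiableOn_zero_charFun`). At a
zero λ one has D(z) = (z - λ)φ(M(z)u(λ)) with nonvanishing second factor (`charFun_eq_mul`). So λ is
the only zero and a simple one, and the spectral projection is P = ψ(·)u, with ψ and u holomorphic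
into X* and X.

It remains to see u(κ) in V, holomorphically. At the eigenvalue w = Bu, and variation of constants
gives a Volterra type equation for w with kernel e^{-λs}BT(s). By (S3) it is solvable in V, by (S2)
its solution in X is unique, so w lies in V (`source_mem_range`). Then u = e^{-λ}T(1)u + ∫₀¹
e^{-λs}T(s)w ds is an integral in V.

The obstacle to holomorphy is uniformity: ‖T(s)w(κ)‖_V is bounded in s for each κ separately, while
the locally uniform bound s^{-α} from (S1) need not be integrable. A Hartogs argument closes the
gap. The functions log⁺‖F_s‖ / log(1/s) are subharmonic in κ, uniformly bounded for small s, and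
tend to 0 pointwise. The area mean value inequality and dominated convergence make them at most 1/2
on a smaller disc, which gives the integrable bound s^{-1/2}
(`exists_bound_rpow_of_pointwise_bound`) and permits differentiation under the integral. -/

theorem log_norm_le_circleAverage {f : ℂ → ℂ} {c : ℂ} {R : ℝ} (hR : 0 < R)
    (hf : AnalyticOnNhd ℂ f (closedBall c |R|)) (hc : f c ≠ 0) :
    log ‖f c‖ ≤ circleAverage (log ‖f ·‖) c R := by
  -- Jensen's formula: the average exceeds log ‖f c‖ by a sum over the zeros u of log (R / ‖c - u‖),
  -- weighted by multiplicity, and each term is nonnegative because the zeros lie within distance R.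
  rw [hf.circleAverage_log_norm hR.ne' hc]
  refine le_add_of_nonneg_left (finsum_nonneg fun u => ?_)
  by_cases hu : u ∈ closedBall c |R|
  · refine mul_nonneg (by exact_mod_cast MeromorphicOn.AnalyticOnNhd.divisor_nonneg hf u) ?_
    by_cases huc : u = c
    -- Here ‖c - u‖⁻¹ = 0, and log 0 = 0 by convention.
    · simp [huc]
    · have h1 : 0 < ‖c - u‖ := norm_pos_iff.2 (sub_ne_zero.2 (Ne.symm huc))
      refine log_nonneg ?_
      rw [← div_eq_mul_inv, one_le_div h1]
      simpa [dist_comm, dist_eq_norm, abs_of_pos hR, mem_closedBall] using hu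
  · rw [Function.locallyFinsuppWithin.apply_eq_zero_of_notMem _ hu]
    simp

/-- Subharmonicity of log⁺‖F‖ follows from the scalar case: a functional l of norm at most 1 that
norms F c reduces the claim to l ∘ F, since ‖l (F z)‖ ≤ ‖F z‖. If ‖F c‖ ≤ 1 the left side vanishes.
-/
theorem posLog_norm_le_circleAverage {F : ℂ → E} {c : ℂ} {R ρ : ℝ} (hR : 0 < R) (hRρ : R < ρ)
    (hF : DifferentiableOn ℂ F (ball c ρ)) :
    posLog ‖F c‖ ≤ circleAverage (fun z => posLog ‖F z‖) c R := by
  have hsub : closedBall c |R| ⊆ ball c ρ := by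
    rw [abs_of_pos hR]; exact closedBall_subset_ball hRρ
  have hcont : ContinuousOn (fun z => posLog ‖F z‖) (sphere c |R|) :=
    continuous_posLog.comp_continuousOn
      ((hF.continuousOn.mono (sphere_subset_closedBall.trans hsub)).norm)
  have hint : CircleIntegrable (fun z => posLog ‖F z‖) c R := by
    rw [abs_of_pos hR] at hcont
    exact hcont.circleIntegrable hR.le
  by_cases h1 : ‖F c‖ ≤ 1
  · rw [(posLog_eq_zero_iff _).2 (by simpa using h1)]
    exact circleAverage_nonneg_of_nonneg fun z _ => posLog_nonneg
  push Not at h1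
  obtain ⟨l, hl1, hl2⟩ := exists_dual_vector'' ℂ (F c)
  have hlc : ‖l (F c)‖ = ‖F c‖ := by rw [hl2]; simp
  have hlan : AnalyticOnNhd ℂ (fun z => l (F z)) (closedBall c |R|) :=
    ((l.differentiable.comp_differentiableOn hF).analyticOnNhd isOpen_ball).mono hsub
  rw [posLog_eq_log (by rw [abs_of_pos (by linarith)]; exact h1.le), ← hlc]
  refine (log_norm_le_circleAverage hR hlan ?_).trans ?_
  · intro h
    change l (F c) = 0 at h
    rw [h, norm_zero] at hlc
    linarith
  · refine circleAverage_mono ?_ hint ?_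
    · exact (hlan.meromorphicOn.mono_set sphere_subset_closedBall).circleIntegrable_log_norm
    · intro z hz
      have hle : ‖l (F z)‖ ≤ ‖F z‖ := by
        refine (l.le_opNorm _).trans ?_
        exact mul_le_of_le_one_left (norm_nonneg _) hl1
      calc log ‖l (F z)‖ ≤ posLog ‖l (F z)‖ := by rw [posLog_apply]; exact le_max_right _ _
        _ ≤ posLog ‖F z‖ := monotoneOn_posLog (norm_nonneg _) (norm_nonneg _) hle

/-- The circle inequality is integrated in polar coordinates over radii between ρ / 2 and ρ only.
There 2πr ≥ πρ, and the radial length ρ / 2 yields the non-sharp constant πρ² / 2. -/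
theorem posLog_norm_le_lintegral {F : ℂ → E} {c : ℂ} {ρ : ℝ} (hρ : 0 < ρ)
    (hF : DifferentiableOn ℂ F (ball c ρ)) :
    ENNReal.ofReal (π * ρ ^ 2 / 2 * posLog ‖F c‖) ≤
      ∫⁻ z in ball c ρ, ENNReal.ofReal (posLog ‖F z‖) := by
  set ψ : ℂ → ℝ := fun z => posLog ‖F z‖ with hψ
  have hψc : ContinuousOn ψ (ball c ρ) := continuous_posLog.comp_continuousOn hF.continuousOn.norm
  set f : ℂ → ENNReal := (ball c ρ).indicator fun z => ENNReal.ofReal (ψ z) with hf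
  have hfm : Measurable f := by
    classical
    rw [hf, ← Set.piecewise_eq_indicator]
    exact (ENNReal.continuous_ofReal.comp_continuousOn hψc).measurable_piecewise
      continuousOn_const measurableSet_ball
  have hcirc : ∀ r θ : ℝ, Complex.polarCoord.symm (r, θ) + c = circleMap c r θ := by
    intro r θ
    simp only [Complex.polarCoord_symm_apply, circleMap, Complex.exp_mul_I, Complex.ofReal_cos,
      Complex.ofReal_sin]
    ring
  have hinner : ∀ r ∈ Ioo (ρ / 2) ρ, ENNReal.ofReal (π * ρ * ψ c) ≤
      ∫⁻ θ in Ioo (-π) π, ENNReal.ofReal r * f (circleMap c r θ) := by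
    intro r hr
    have hr0 : 0 < r := by linarith [hr.1]
    have hmem : ∀ θ, circleMap c r θ ∈ ball c ρ := fun θ => by
      simpa [mem_ball, dist_eq_norm, circleMap, abs_of_pos hr0] using hr.2
    have hcθ : Continuous fun θ => r * ψ (circleMap c r θ) :=
      continuous_const.mul (hψc.comp_continuous (continuous_circleMap c r) hmem)
    have h1 : π * ρ * ψ c ≤ ∫ θ in Ioo (-π) π, r * ψ (circleMap c r θ) := by
      have h2 := posLog_norm_le_circleAverage hr0 hr.2 hF
      have h3 : ∫ θ in Ioo (-π) π, r * ψ (circleMap c r θ) = r * (2 * π) * circleAverage ψ c r := by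
        rw [← integral_Ioc_eq_integral_Ioo, ← intervalIntegral.integral_of_le (by linarith [pi_pos]),
          intervalIntegral.integral_const_mul, circleAverage_eq_integral_add (-π),
          intervalIntegral.integral_comp_add_right (fun θ => ψ (circleMap c r θ))]
        have : (2 * π + -π) = π := by ring
        rw [this, zero_add, smul_eq_mul]
        field_simp
      rw [h3]
      have h4 : 0 ≤ ψ c := posLog_nonneg
      have h5 : ψ c ≤ circleAverage ψ c r := h2
      calc π * ρ * ψ c ≤ r * (2 * π) * ψ c := by
            refine mul_le_mul_of_nonneg_right ?_ h4
            nlinarith [hr.1, pi_pos]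
        _ ≤ _ := mul_le_mul_of_nonneg_left h5 (by positivity)
    refine (ENNReal.ofReal_le_ofReal h1).trans (le_of_eq ?_)
    rw [ofReal_integral_eq_lintegral_ofReal
      ((hcθ.integrableOn_Icc (a := -π) (b := π)).mono_set Ioo_subset_Icc_self)
      (ae_of_all _ fun θ => mul_nonneg hr0.le posLog_nonneg)]
    refine lintegral_congr fun θ => ?_
    rw [ENNReal.ofReal_mul hr0.le, hf, indicator_of_mem (hmem θ)]
  calc ENNReal.ofReal (π * ρ ^ 2 / 2 * ψ c)
      = ∫⁻ _ in Ioo (ρ / 2) ρ, ENNReal.ofReal (π * ρ * ψ c) := by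
        rw [setLIntegral_const, Real.volume_Ioo, ← ENNReal.ofReal_mul
          (mul_nonneg (by positivity) posLog_nonneg)]
        congr 1; ring
    _ ≤ ∫⁻ r in Ioo (ρ / 2) ρ, ∫⁻ θ in Ioo (-π) π, ENNReal.ofReal r * f (circleMap c r θ) :=
        setLIntegral_mono' measurableSet_Ioo hinner
    _ = ∫⁻ p in Ioo (ρ / 2) ρ ×ˢ Ioo (-π) π,
          ENNReal.ofReal p.1 • f (Complex.polarCoord.symm p + c) := by
        rw [Measure.volume_eq_prod, setLIntegral_prod]
        · simp only [hcirc, smul_eq_mul]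
        · simp only [Complex.polarCoord_symm_apply, smul_eq_mul]
          refine Measurable.aemeasurable ?_
          refine (ENNReal.measurable_ofReal.comp measurable_fst).mul (hfm.comp ?_)
          fun_prop
    _ ≤ ∫⁻ p in polarCoord.target,
          ENNReal.ofReal p.1 • f (Complex.polarCoord.symm p + c) := by
        refine lintegral_mono_set (prod_mono (fun r hr => ?_) subset_rfl)
        exact lt_trans (by positivity) hr.1
    _ = ∫⁻ z, f (z + c) := Complex.lintegral_comp_polarCoord_symm fun z => f (z + c)
    _ = ∫⁻ z, f z := lintegral_add_right_eq_self f c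
    _ = _ := lintegral_indicator measurableSet_ball _

/-- Holomorphic functions `F s`, `s ∈ (0, 1]`, that are bounded by `K * s ^ (-α)` and pointwise
bounded as `s` varies are bounded by a multiple of `s ^ (-1 / 2)` on smaller discs. -/
theorem exists_bound_rpow_of_pointwise_bound {F : ℝ → ℂ → E} {c : ℂ} {ρ K α : ℝ} (hρ : 0 < ρ)
    (hα : 0 < α)
    (hF : ∀ s ∈ Ioc (0 : ℝ) 1, DifferentiableOn ℂ (F s) (ball c (2 * ρ)))
    (hK : ∀ s ∈ Ioc (0 : ℝ) 1, ∀ z ∈ ball c (2 * ρ), ‖F s z‖ ≤ K * s ^ (-α))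
    (hp : ∀ z ∈ ball c (2 * ρ), ∃ m, ∀ s ∈ Ioc (0 : ℝ) 1, ‖F s z‖ ≤ m) :
    ∃ C, ∀ s ∈ Ioc (0 : ℝ) 1, ∀ z ∈ ball c ρ, ‖F s z‖ ≤ C * s ^ (-(1 / 2) : ℝ) := by
  -- Dominated convergence: once log s⁻¹ ≥ 1, the bound K * s ^ (-α) dominates the quotient by the
  -- constant log⁺ K + α, while the pointwise bound m makes it at most log⁺ m / log s⁻¹, which tends
  -- to 0.
  have hlim : Tendsto (fun s => ∫⁻ z in ball c (2 * ρ),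
      ENNReal.ofReal (posLog ‖F s z‖ / log s⁻¹)) (𝓝[>] 0)
      (𝓝 (∫⁻ _ in ball c (2 * ρ), (0 : ENNReal))) := by
    have hsmall : ∀ᶠ s in 𝓝[>] (0 : ℝ), s ∈ Ioc (0 : ℝ) 1 ∧ 1 ≤ log s⁻¹ := by
      have h1 : Tendsto (fun s : ℝ => log s⁻¹) (𝓝[>] 0) atTop :=
        tendsto_log_atTop.comp tendsto_inv_nhdsGT_zero
      filter_upwards [h1.eventually_ge_atTop 1, Ioc_mem_nhdsGT (zero_lt_one' ℝ)] with s hs hs'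
      exact ⟨hs', hs⟩
    refine tendsto_lintegral_filter_of_dominated_convergence'
      (fun _ => ENNReal.ofReal (posLog K + α)) ?_ ?_ ?_ ?_
    · filter_upwards [hsmall] with s hs
      refine ContinuousOn.aemeasurable ?_ measurableSet_ball
      exact ENNReal.continuous_ofReal.comp_continuousOn
        ((continuous_posLog.comp_continuousOn (hF s hs.1).continuousOn.norm).div_const _)
    · filter_upwards [hsmall] with s hs
      filter_upwards [ae_restrict_mem measurableSet_ball] with z hz
      refine ENNReal.ofReal_le_ofReal ?_
      rw [div_le_iff₀ (by linarith)]
      have h2 : posLog ‖F s z‖ ≤ posLog K + posLog (s ^ (-α)) :=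
        (monotoneOn_posLog (norm_nonneg _) ((norm_nonneg _).trans (hK s hs.1 z hz))
          (hK s hs.1 z hz)).trans posLog_mul
      have h3 : posLog (s ^ (-α)) = α * log s⁻¹ := by
        rw [posLog_eq_log, log_rpow hs.1.1, log_inv]
        · ring
        · rw [abs_of_pos (rpow_pos_of_pos hs.1.1 _)]
          exact one_le_rpow_of_pos_of_le_one_of_nonpos hs.1.1 hs.1.2 (by linarith)
      have h4 : posLog K ≤ posLog K * log s⁻¹ := le_mul_of_one_le_right posLog_nonneg hs.2
      linarith
    · rw [setLIntegral_const]
      exact ENNReal.mul_ne_top ENNReal.ofReal_ne_top measure_ball_lt_top.ne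
    · filter_upwards [ae_restrict_mem measurableSet_ball] with z hz
      obtain ⟨m, hm⟩ := hp z hz
      have h1 : Tendsto (fun s : ℝ => log s⁻¹) (𝓝[>] 0) atTop :=
        tendsto_log_atTop.comp tendsto_inv_nhdsGT_zero
      have h2 : Tendsto (fun s => posLog ‖F s z‖ / log s⁻¹) (𝓝[>] 0) (𝓝 0) := by
        refine squeeze_zero' ?_ ?_ (h1.const_div_atTop (posLog m))
        · filter_upwards [hsmall] with s hs
          exact div_nonneg posLog_nonneg (by linarith)
        · filter_upwards [hsmall] with s hs
          exact div_le_div_of_nonneg_right (monotoneOn_posLog (norm_nonneg _)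
            ((norm_nonneg _).trans (hm s hs.1)) (hm s hs.1)) (by linarith)
      simpa using ENNReal.tendsto_ofReal h2
  -- The threshold πρ² / 4 is half the constant of the area inequality, so that it gives log⁺‖F s z‖
  -- ≤ (1 / 2) log s⁻¹, which is the exponent -1 / 2.
  have hev : ∀ᶠ s in 𝓝[>] (0 : ℝ), s ∈ Ioo (0 : ℝ) 1 ∧ ∫⁻ z in ball c (2 * ρ),
      ENNReal.ofReal (posLog ‖F s z‖ / log s⁻¹) < ENNReal.ofReal (π * ρ ^ 2 / 4) := by
    rw [lintegral_zero] at hlim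
    filter_upwards [hlim.eventually_lt_const (show (0 : ENNReal) < ENNReal.ofReal (π * ρ ^ 2 / 4) from
      ENNReal.ofReal_pos.2 (by positivity)), Ioo_mem_nhdsGT (zero_lt_one' ℝ)] with s hs hs'
    exact ⟨hs', hs⟩
  obtain ⟨s₁, hs₁, hs₁'⟩ := mem_nhdsGT_iff_exists_Ioo_subset.1 hev
  have hs₁0 : (0 : ℝ) < s₁ := hs₁
  have hsmall : ∀ s ∈ Ioo (0 : ℝ) s₁, ∀ z ∈ ball c ρ, ‖F s z‖ ≤ s ^ (-(1 / 2) : ℝ) := by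
    intro s hs z hz
    obtain ⟨hs01, hI⟩ := hs₁' hs
    have hsub : ball z ρ ⊆ ball c (2 * ρ) :=
      ball_subset_ball' (by linarith [mem_ball.1 hz])
    have hlog : 0 < log s⁻¹ := log_pos (one_lt_inv₀ hs01.1 |>.2 hs01.2)
    have h1 := posLog_norm_le_lintegral hρ ((hF s ⟨hs01.1, hs01.2.le⟩).mono hsub)
    have h2 : ENNReal.ofReal (π * ρ ^ 2 / 2 * posLog ‖F s z‖) <
        ENNReal.ofReal (log s⁻¹) * ENNReal.ofReal (π * ρ ^ 2 / 4) := by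
      refine h1.trans_lt (lt_of_le_of_lt ?_ (ENNReal.mul_lt_mul_right
        (ENNReal.ofReal_pos.2 hlog).ne' ENNReal.ofReal_ne_top hI))
      rw [← lintegral_const_mul' _ _ ENNReal.ofReal_ne_top]
      refine (lintegral_mono_set hsub).trans (le_of_eq (lintegral_congr fun w => ?_))
      rw [← ENNReal.ofReal_mul hlog.le]
      rw [mul_div_cancel₀ _ hlog.ne']
    rw [← ENNReal.ofReal_mul hlog.le, ENNReal.ofReal_lt_ofReal_iff (by positivity)] at h2
    have h3 : posLog ‖F s z‖ ≤ 1 / 2 * log s⁻¹ := by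
      have : 0 < π * ρ ^ 2 := by positivity
      nlinarith
    rcases (norm_nonneg (F s z)).eq_or_lt with h0 | h0
    · rw [← h0]; exact rpow_nonneg hs01.1.le _
    · rw [← log_le_log_iff h0 (rpow_pos_of_pos hs01.1 _), log_rpow hs01.1]
      have h4 : log ‖F s z‖ ≤ posLog ‖F s z‖ := by rw [posLog_apply]; exact le_max_right _ _
      rw [log_inv] at h3
      linarith
  -- The second entry covers s ≥ s₁, where the crude bound K * s ^ (-α) suffices.
  refine ⟨max 1 (|K| * s₁ ^ (-α)), fun s hs z hz => ?_⟩
  have hone : 1 ≤ s ^ (-(1 / 2) : ℝ) :=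
    one_le_rpow_of_pos_of_le_one_of_nonpos hs.1 hs.2 (by norm_num)
  rcases lt_or_ge s s₁ with h | h
  · exact (hsmall s ⟨hs.1, h⟩ z hz).trans
      (le_mul_of_one_le_left (by linarith) (le_max_left _ _))
  · have h1 : s ^ (-α) ≤ s₁ ^ (-α) := rpow_le_rpow_of_nonpos hs₁0 h (by linarith)
    calc ‖F s z‖ ≤ K * s ^ (-α) := hK s hs z (ball_subset_ball (by linarith) hz)
      _ ≤ |K| * s₁ ^ (-α) := mul_le_mul (le_abs_self K) h1 (rpow_nonneg hs.1.le _) (abs_nonneg _)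
      _ ≤ max 1 (|K| * s₁ ^ (-α)) := le_max_right _ _
      _ ≤ _ := le_mul_of_one_le_right (le_max_of_le_left zero_le_one) hone

end Hartogs

/-! ### Strong and norm holomorphy -/

section StrongHolomorphy

variable {E F : Type*} [NormedAddCommGroup E] [NormedSpace ℂ E] [CompleteSpace E]
  [NormedAddCommGroup F] [NormedSpace ℂ F] [CompleteSpace F]

/-- A strongly holomorphic family of bounded operators is holomorphic in operator norm. -/
theorem differentiableOn_of_forall_apply {C : ℂ → E →L[ℂ] F} {U : Set ℂ} (hU : IsOpen U)
    (h : ∀ x, DifferentiableOn ℂ (fun κ => C κ x) U) : DifferentiableOn ℂ C U := by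
  intro κ₀ hκ₀
  obtain ⟨ε, hε, hεU⟩ := Metric.isOpen_iff.1 hU κ₀ hκ₀
  set ρ : ℝ := ε / 3 with hρdef
  have hρ : 0 < ρ := by positivity
  have hsub : closedBall κ₀ (2 * ρ) ⊆ U :=
    (closedBall_subset_ball (by rw [hρdef]; linarith)).trans hεU
  -- The uniform boundedness principle makes the family locally bounded in operator norm. The
  -- Schwarz estimate, applied to each orbit with a constant proportional to ‖x‖, then gives norm
  -- continuity.
  obtain ⟨M, hM⟩ : ∃ M, ∀ z : closedBall κ₀ (2 * ρ), ‖C z‖ ≤ M := by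
    refine banach_steinhaus fun x => ?_
    obtain ⟨K, hK⟩ := (isCompact_closedBall κ₀ (2 * ρ)).exists_bound_of_continuousOn
      ((h x).continuousOn.mono hsub)
    exact ⟨K, fun z => hK z z.2⟩
  have hM' : ∀ z ∈ closedBall κ₀ (2 * ρ), ‖C z‖ ≤ M := fun z hz => hM ⟨z, hz⟩
  have hM0 : 0 ≤ M := (norm_nonneg _).trans (hM' κ₀ (mem_closedBall_self (by positivity)))
  have hcont : ContinuousOn C (closedBall κ₀ ρ) := by
    intro z hz
    have hzsub : ball z ρ ⊆ closedBall κ₀ (2 * ρ) := by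
      refine ball_subset_closedBall.trans (closedBall_subset_closedBall' ?_)
      linarith [mem_closedBall.1 hz]
    have hlip : ∀ w ∈ ball z ρ, dist (C w) (C z) ≤ 2 * M / ρ * dist w z := by
      intro w hw
      rw [dist_eq_norm]
      refine ContinuousLinearMap.opNorm_le_bound _ (by positivity) fun x => ?_
      have := Complex.dist_le_div_mul_dist_of_mapsTo_ball (f := fun κ => C κ x) (c := z)
        (R₂ := 2 * M * ‖x‖) ((h x).mono (hzsub.trans hsub)) (fun v hv => ?_) hw
      · rw [dist_eq_norm] at this
        refine this.trans (le_of_eq ?_)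
        ring
      · rw [mem_closedBall, dist_eq_norm]
        refine (norm_sub_le _ _).trans ?_
        have h1 := (C v).le_of_opNorm_le (hM' v (hzsub hv)) x
        have h2 := (C z).le_of_opNorm_le (hM' z (hzsub (mem_ball_self hρ))) x
        linarith
    refine ContinuousAt.continuousWithinAt ?_
    rw [ContinuousAt, tendsto_iff_dist_tendsto_zero]
    refine squeeze_zero' (Eventually.of_forall fun _ => dist_nonneg)
      (eventually_of_mem (ball_mem_nhds z hρ) hlip) ?_
    have : Tendsto (fun w => 2 * M / ρ * dist w z) (𝓝 z) (𝓝 (2 * M / ρ * dist z z)) :=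
      (continuous_const.mul (continuous_id.dist continuous_const)).tendsto z
    simpa using this
  have hint : CircleIntegrable C κ₀ ρ :=
    (hcont.mono sphere_subset_closedBall).circleIntegrable hρ.le
  lift ρ to NNReal using hρ.le with ρ'
  -- By norm continuity the Cauchy integral of C exists in operator norm and is analytic; evaluating
  -- at each x identifies it with C.
  have hps := hasFPowerSeriesOn_cauchy_integral hint (by exact_mod_cast hρ)
  have hd := hps.analyticAt.differentiableAt
  refine (hd.congr_of_eventuallyEq ?_).differentiableWithinAt
  filter_upwards [ball_mem_nhds κ₀ hρ] with w hw
  ext x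
  have hci : CircleIntegrable (fun z => (z - w)⁻¹ • C z) κ₀ ρ' := by
    refine ContinuousOn.circleIntegrable hρ.le (ContinuousOn.fun_smul ?_
      (hcont.mono sphere_subset_closedBall))
    refine (continuousOn_id.sub continuousOn_const).inv₀ fun z hz => sub_ne_zero.2 ?_
    rintro rfl
    exact (ne_of_lt (mem_ball.1 hw)) (mem_sphere.1 hz)
  have hdx : DifferentiableOn ℂ (fun z => C z x) (closedBall κ₀ ρ') :=
    (h x).mono ((closedBall_subset_closedBall (by linarith)).trans hsub)
  rw [smul_apply]
  have happ : (∮ z in C(κ₀, ρ'), (z - w)⁻¹ • C z) x = ∮ z in C(κ₀, ρ'), (z - w)⁻¹ • C z x := by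
    rw [circleIntegral, circleIntegral, ContinuousLinearMap.intervalIntegral_apply hci.out]
    rfl
  rw [happ, hdx.circleIntegral_sub_inv_smul hw, smul_smul, inv_mul_cancel₀, one_smul]
  simp [Real.pi_ne_zero, Complex.I_ne_zero]

end StrongHolomorphy

/-! ### Graphs and resolvents -/

section Resolvent

variable {X : Type*} [NormedAddCommGroup X] [NormedSpace ℂ X] {A : X →ₗ.[ℂ] X}

theorem mk_mem_graph_iff {x y : X} : (x, y) ∈ A.graph ↔ ∃ h : x ∈ A.domain, A ⟨x, h⟩ = y := by
  rw [LinearPMap.mem_graph_iff]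
  constructor
  · rintro ⟨⟨x', hx'⟩, rfl, h⟩
    exact ⟨hx', h⟩
  · rintro ⟨h, rfl⟩
    exact ⟨⟨x, h⟩, rfl, rfl⟩

theorem val_eq_of_mem_graph {x y : X} (h : (x, y) ∈ A.graph) : val A x = y := by
  obtain ⟨hx, rfl⟩ := mk_mem_graph_iff.1 h
  exact dif_pos hx

theorem isResolventAt_iff {z : ℂ} {R : X →L[ℂ] X} : IsResolventAt A z R ↔
    (∀ y, (R y, z • R y - y) ∈ A.graph) ∧ ∀ x a, (x, a) ∈ A.graph → R (z • x - a) = x := by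
  refine and_congr (forall_congr' fun y => ?_) ⟨fun h x a hxa => ?_, fun h x => ?_⟩
  · rw [mk_mem_graph_iff]
    refine exists_congr fun h => ?_
    rw [sub_eq_iff_eq_add', eq_sub_iff_add_eq, eq_comm]
  · obtain ⟨hx, rfl⟩ := mk_mem_graph_iff.1 hxa
    exact h ⟨x, hx⟩
  · exact h x (A x) (A.mem_graph x)

/-- One bounded resolvent turns membership in the graph of an unbounded operator into an equation,
which can be passed to limits. -/
theorem IsResolventAt.mem_graph_iff {z : ℂ} {R : X →L[ℂ] X} (hR : IsResolventAt A z R) {x a : X} :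
    (x, a) ∈ A.graph ↔ R (z • x - a) = x := by
  rw [isResolventAt_iff] at hR
  refine ⟨hR.2 x a, fun h => ?_⟩
  have := hR.1 (z • x - a)
  rwa [h, sub_sub_cancel] at this

theorem IsResolventAt.unique {z : ℂ} {R S : X →L[ℂ] X} (hR : IsResolventAt A z R)
    (hS : IsResolventAt A z S) : R = S := by
  ext y
  have h1 := (isResolventAt_iff.1 hS).1 y
  have h2 := (isResolventAt_iff.1 hR).2 _ _ h1
  rwa [sub_sub_cancel] at h2

theorem isResolventAt_resolvent {z : ℂ} (hz : z ∈ resolventSet A) :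
    IsResolventAt A z (resolvent A z) := by
  rw [resolvent, dif_pos hz]
  exact hz.choose_spec

theorem IsResolventAt.resolvent_eq {z : ℂ} {R : X →L[ℂ] X} (hR : IsResolventAt A z R) :
    resolvent A z = R :=
  (isResolventAt_resolvent ⟨R, hR⟩).unique hR

/-- The first resolvent identity. -/
theorem IsResolventAt.sub_smul_apply {z w : ℂ} {R S : X →L[ℂ] X} (hR : IsResolventAt A z R)
    (hS : IsResolventAt A w S) (y : X) : S y = R y + (z - w) • R (S y) := by
  have h := (isResolventAt_iff.1 hR).2 _ _ ((isResolventAt_iff.1 hS).1 y)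
  calc S y = R (z • S y - (w • S y - y)) := h.symm
    _ = R (y + (z - w) • S y) := by congr 1; rw [sub_smul]; abel
    _ = _ := by rw [map_add, map_smul]

/-- The factorisation w - A = (1 + (w - z)R)(z - A) on dom(A), where R commutes with the first
factor. -/
theorem IsResolventAt.of_isUnit {z w : ℂ} {R : X →L[ℂ] X} (hR : IsResolventAt A z R)
    (hw : IsUnit (1 + (w - z) • R)) :
    IsResolventAt A w (R * Ring.inverse (1 + (w - z) • R)) := by
  set S := 1 + (w - z) • R with hS
  have hRS : Commute R S := by
    refine (Commute.one_right R).add_right ?_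
    exact (Commute.refl R).smul_right _
  have h1 : S * Ring.inverse S = 1 := Ring.mul_inverse_cancel _ hw
  have h2 : Ring.inverse S * S = 1 := Ring.inverse_mul_cancel _ hw
  have hRI : R * Ring.inverse S = Ring.inverse S * R := by
    calc R * Ring.inverse S = Ring.inverse S * S * (R * Ring.inverse S) := by rw [h2, one_mul]
      _ = Ring.inverse S * (S * R) * Ring.inverse S := by simp only [mul_assoc]
      _ = Ring.inverse S * (R * S) * Ring.inverse S := by rw [hRS.eq]
      _ = Ring.inverse S * R * (S * Ring.inverse S) := by simp only [mul_assoc]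
      _ = _ := by rw [h1, mul_one]
  rw [isResolventAt_iff]
  constructor
  · intro y
    rw [hR.mem_graph_iff]
    have h3 : ∀ y, Ring.inverse S y + (w - z) • R (Ring.inverse S y) = y := fun y => by
      have := DFunLike.congr_fun h1 y
      simpa [hS] using this
    have h4 := congrArg R (h3 y)
    set v := Ring.inverse S y
    change R (z • R v - (w • R v - y)) = R v
    simp only [map_add, map_smul, map_sub] at h4 ⊢
    rw [← h4, sub_smul]
    abel
  · intro x a hxa
    have h5 := hR.mem_graph_iff.1 hxa
    have h6 : R (w • x - a) = S x := by
      have : w • x - a = (z • x - a) + (w - z) • x := by rw [sub_smul]; abel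
      rw [this, map_add, h5, map_smul]
      simp [hS]
    rw [hRI]
    change Ring.inverse S (R (w • x - a)) = x
    rw [h6]
    exact DFunLike.congr_fun h2 x

variable [CompleteSpace X]

theorem eventually_isResolventAt {z : ℂ} (hz : z ∈ resolventSet A) :
    ∀ᶠ w in 𝓝 z, IsResolventAt A w
      (resolvent A z * Ring.inverse (1 + (w - z) • resolvent A z)) := by
  have hcont : ContinuousAt (fun w : ℂ => 1 + (w - z) • resolvent A z) z := by fun_prop
  have h0 : (1 : X →L[ℂ] X) + (z - z) • resolvent A z = 1 := by simp
  have hunit : ∀ᶠ w in 𝓝 z, IsUnit (1 + (w - z) • resolvent A z) := by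
    refine hcont.eventually (Units.isOpen.mem_nhds ?_)
    change IsUnit (1 + (z - z) • resolvent A z)
    rw [h0]
    exact isUnit_one
  filter_upwards [hunit] with w hw
  exact (isResolventAt_resolvent hz).of_isUnit hw

theorem analyticAt_resolvent {z : ℂ} (hz : z ∈ resolventSet A) :
    AnalyticAt ℂ (resolvent A) z := by
  have h : AnalyticAt ℂ
      (fun w => resolvent A z * Ring.inverse (1 + (w - z) • resolvent A z)) z := by
    refine analyticAt_const.mul (AnalyticAt.fun_comp ?_ ?_)
    · have := analyticAt_inverse (𝕜 := ℂ) (1 : (X →L[ℂ] X)ˣ)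
      simpa using this
    · fun_prop
  refine h.congr ?_
  filter_upwards [eventually_isResolventAt hz] with w hw
  exact hw.resolvent_eq.symm

end Resolvent

/-! ### The resolvent near an algebraically simple pole -/

section SimplePole

variable {X : Type*} [NormedAddCommGroup X] [NormedSpace ℂ X] {A : X →ₗ.[ℂ] X}

theorem mem_kerPow_succ {μ : ℂ} {m : ℕ} {x : X} :
    x ∈ kerPow A μ (m + 1) ↔ ∃ a, (x, a) ∈ A.graph ∧ μ • x - a ∈ kerPow A μ m := by
  rw [kerPow, Submodule.mem_map]
  constructor
  · rintro ⟨y, hy, rfl⟩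
    exact ⟨A y, A.mem_graph y, hy⟩
  · rintro ⟨a, ha, h⟩
    obtain ⟨hx, rfl⟩ := mk_mem_graph_iff.1 ha
    exact ⟨⟨x, hx⟩, h, rfl⟩

theorem mem_genEigenspace_of_mem_kerPow {μ : ℂ} {m : ℕ} {x : X} (h : x ∈ kerPow A μ m) :
    x ∈ genEigenspace A μ :=
  (le_iSup (kerPow A μ) m) h

theorem mem_kerPow_one {μ : ℂ} {x : X} (h : (x, μ • x) ∈ A.graph) : x ∈ kerPow A μ 1 :=
  mem_kerPow_succ.2 ⟨μ • x, h, by simp [kerPow]⟩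

theorem IsAlgSimple.exists_smul_eq {μ : ℂ} (h : IsAlgSimple A μ) {x y : X}
    (hx : x ∈ genEigenspace A μ) (hx0 : x ≠ 0) (hy : y ∈ genEigenspace A μ) :
    ∃ c : ℂ, c • x = y := by
  obtain ⟨c, hc⟩ := exists_smul_eq_of_finrank_eq_one h (x := (⟨x, hx⟩ : genEigenspace A μ))
    (by simpa [Subtype.ext_iff] using hx0) ⟨y, hy⟩
  exact ⟨c, by simpa [Subtype.ext_iff] using hc⟩

theorem eq_of_eventuallyEq_punctured {Y : Type*} [TopologicalSpace Y] [T2Space Y] {f g : ℂ → Y}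
    {z : ℂ} (hf : ContinuousAt f z) (hg : ContinuousAt g z) (h : ∀ᶠ w in 𝓝[≠] z, f w = g w) :
    f z = g z :=
  tendsto_nhds_unique_of_eventuallyEq (hf.mono_left nhdsWithin_le_nhds)
    (hg.mono_left nhdsWithin_le_nhds) h

/-- The data of a simple pole of the resolvent on `closedBall lam₀ r`, with one-dimensional residue:
`(z - A)⁻¹ = (z - lam₀)⁻¹ φ(·) e + H z`. -/
structure IsSimplePoleDecomposition (A : X →ₗ.[ℂ] X) (lam₀ : ℂ) (r : ℝ) (e : X) (φ : X →L[ℂ] ℂ)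
    (H : ℂ → X →L[ℂ] X) : Prop where
  apply_eigenvector : φ e = 1
  eigenvector : (e, lam₀ • e) ∈ A.graph
  analytic : AnalyticOnNhd ℂ H (closedBall lam₀ r)
  right_inv : ∀ z ∈ closedBall lam₀ r, ∀ y, (H z y, z • H z y - (y - φ y • e)) ∈ A.graph
  left_inv : ∀ z ∈ closedBall lam₀ r, ∀ x a, (x, a) ∈ A.graph → H z (z • x - a) = x - φ x • e
  apply_regular : ∀ z ∈ closedBall lam₀ r, ∀ y, φ (H z y) = 0
  apply_graph : ∀ x a, (x, a) ∈ A.graph → φ a = lam₀ * φ x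

/-- At an algebraically simple eigenvalue a pole of the resolvent is simple, and its residue has
range in the eigenspace. -/
theorem exists_residue {lam₀ : ℂ} (hpole : IsResolventPole A lam₀) (hsimple : IsAlgSimple A lam₀) :
    ∃ g : ℂ → X →L[ℂ] X, AnalyticAt ℂ g lam₀ ∧ g lam₀ ≠ 0 ∧
      (∀ᶠ z in 𝓝[≠] lam₀, z ∈ resolventSet A ∧ resolvent A z = (z - lam₀)⁻¹ • g z) ∧
      ∀ y, (g lam₀ y, lam₀ • g lam₀ y) ∈ A.graph := by
  obtain ⟨-, hev, hmer, hord⟩ := hpole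
  obtain ⟨n, hn⟩ := WithTop.ne_top_iff_exists.1 hord.ne_top
  obtain ⟨g, hg, hg0, hgeq⟩ := (meromorphicOrderAt_eq_int_iff hmer).1 hn.symm
  have hn0 : n < 0 := by rw [← hn] at hord; exact_mod_cast hord
  -- The pole has order m + 1; the goal is m = 0.
  obtain ⟨m, hm⟩ : ∃ m : ℕ, n = -((m : ℤ) + 1) := ⟨(-n - 1).toNat, by omega⟩
  have hgR : ∀ᶠ z in 𝓝[≠] lam₀, g z = (z - lam₀) ^ (m + 1) • resolvent A z := by
    filter_upwards [hgeq, self_mem_nhdsWithin] with z hz hne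
    have hne' : z - lam₀ ≠ 0 := sub_ne_zero.2 hne
    rw [hz, smul_smul, hm, ← zpow_natCast, ← zpow_add₀ hne']
    simp
  obtain ⟨z₀, hz₀⟩ : ∃ z₀, z₀ ∈ resolventSet A := hev.exists
  set R₀ := resolvent A z₀
  have hR₀ : IsResolventAt A z₀ R₀ := isResolventAt_resolvent hz₀
  have hident : ∀ᶠ z in 𝓝[≠] lam₀, ∀ y, g z y =
      (z - lam₀) ^ (m + 1) • R₀ y + (z₀ - z) • R₀ (g z y) := by
    filter_upwards [hgR, hev] with z hz hzR y
    have h1 := hR₀.sub_smul_apply (isResolventAt_resolvent hzR) y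
    rw [hz]
    simp only [smul_apply, map_smul]
    conv_lhs => rw [h1]
    rw [smul_add, smul_comm]
  have hgc := hg.continuousAt
  have hgy : ∀ y, AnalyticAt ℂ (fun z => g z y) lam₀ := fun y =>
    (ContinuousLinearMap.apply ℂ X y).analyticAt _ |>.comp hg
  have hgr : ∀ y, AnalyticAt ℂ (fun z => (z - lam₀) ^ (m + 1) • R₀ y + (z₀ - z) • R₀ (g z y))
      lam₀ := fun y => by
    have h1 : AnalyticAt ℂ (fun z => R₀ (g z y)) lam₀ :=
      AnalyticAt.comp (g := R₀) (f := fun z => g z y) (R₀.analyticAt _) (hgy y)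
    have h2 : AnalyticAt ℂ (fun z : ℂ => (z - lam₀) ^ (m + 1)) lam₀ := by fun_prop
    have h3 : AnalyticAt ℂ (fun z : ℂ => z₀ - z) lam₀ := by fun_prop
    exact (h2.smul analyticAt_const).add (h3.smul h1)
  -- The resolvent identity, multiplied by (z - lam₀) ^ (m + 1), in the limit z → lam₀: the leading
  -- coefficient maps into the eigenspace.
  have hident0 : ∀ y, g lam₀ y = (z₀ - lam₀) • R₀ (g lam₀ y) := fun y => by
    have := eq_of_eventuallyEq_punctured (hgy y).continuousAt (hgr y).continuousAt
      (hident.mono fun z hz => hz y)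
    simpa using this
  have hker : ∀ y, (g lam₀ y, lam₀ • g lam₀ y) ∈ A.graph := fun y => by
    rw [hR₀.mem_graph_iff, ← sub_smul, map_smul]
    exact (hident0 y).symm
  -- If m ≥ 1, differentiating the same identity at lam₀ shows that x, the derivative of g(·)y,
  -- satisfies (A - lam₀)x = g(lam₀)y. This is a Jordan chain of length two, which algebraic
  -- simplicity excludes.
  have hm0 : m = 0 := by
    by_contra hm0
    obtain ⟨y, hy⟩ : ∃ y, g lam₀ y ≠ 0 := by
      by_contra! h
      exact hg0 (ContinuousLinearMap.ext h)
    set x := deriv (fun z => g z y) lam₀ with hx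
    have hd := (hgy y).differentiableAt.hasDerivAt
    have hd' : HasDerivAt (fun z => (z - lam₀) ^ (m + 1) • R₀ y + (z₀ - z) • R₀ (g z y))
        (-(R₀ (g lam₀ y)) + (z₀ - lam₀) • R₀ x) lam₀ := by
      have h1 : HasDerivAt (fun z : ℂ => (z - lam₀) ^ (m + 1)) 0 lam₀ := by
        have := ((hasDerivAt_id lam₀).sub_const lam₀).fun_pow (m + 1)
        simpa [hm0] using this
      have h2 : HasDerivAt (fun z : ℂ => z₀ - z) (-1) lam₀ := by
        simpa using (hasDerivAt_id lam₀).const_sub z₀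
      have h3 := R₀.hasFDerivAt.comp_hasDerivAt lam₀ hd
      refine ((h1.smul_const (R₀ y)).fun_add (h2.fun_smul h3)).congr_deriv ?_
      rw [zero_smul, zero_add, neg_smul, one_smul, add_comm]
      rfl
    have hEq : (fun z => g z y) =ᶠ[𝓝 lam₀]
        fun z => (z - lam₀) ^ (m + 1) • R₀ y + (z₀ - z) • R₀ (g z y) := by
      have h1 : ∀ᶠ z in 𝓝[≠] lam₀, g z y = (z - lam₀) ^ (m + 1) • R₀ y + (z₀ - z) • R₀ (g z y) :=
        hident.mono fun z hz => hz y
      exact ((hgy y).frequently_eq_iff_eventually_eq (hgr y)).1 h1.frequently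
    have hxeq : x = -(R₀ (g lam₀ y)) + (z₀ - lam₀) • R₀ x :=
      (hd.congr_of_eventuallyEq hEq.symm).unique hd'
    have hxg : (x, lam₀ • x + g lam₀ y) ∈ A.graph := by
      rw [hR₀.mem_graph_iff]
      conv_rhs => rw [hxeq]
      rw [← sub_sub, ← sub_smul, map_sub, map_smul]
      abel
    have hx2 : x ∈ kerPow A lam₀ 2 := by
      refine mem_kerPow_succ.2 ⟨_, hxg, ?_⟩
      rw [sub_add_cancel_left]
      exact Submodule.neg_mem _ (mem_kerPow_one (hker y))
    obtain ⟨c, hc⟩ := hsimple.exists_smul_eq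
      (mem_genEigenspace_of_mem_kerPow (mem_kerPow_one (hker y))) hy
      (mem_genEigenspace_of_mem_kerPow hx2)
    have h4 : (x, lam₀ • x) ∈ A.graph := by
      have := A.graph.smul_mem c (hker y)
      rw [Prod.smul_mk, smul_comm, hc] at this
      exact this
    have h5 := LinearPMap.mem_graph_snd_inj A h4 hxg rfl
    exact hy (by simpa using h5)
  refine ⟨g, hg, hg0, ?_, hker⟩
  filter_upwards [hgeq, hev] with z hz hzR
  refine ⟨hzR, ?_⟩
  rw [hz, hm, hm0]
  simp

/-- The residue maps into a one-dimensional eigenspace, so it has the form φ(·)e. Subtracting the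
singular part leaves a removable singularity, and the resolvent identities extend from the punctured
disc to lam₀ by continuity. -/
theorem exists_isSimplePoleDecomposition [CompleteSpace X] {lam₀ : ℂ} (hpole : IsResolventPole A lam₀)
    (hsimple : IsAlgSimple A lam₀) {r : ℝ} (hiso : closedBall lam₀ r ∩ spec A = {lam₀}) :
    ∃ e φ H, IsSimplePoleDecomposition A lam₀ r e φ H := by
  obtain ⟨g, hg, hg0, hgeq, hker⟩ := exists_residue hpole hsimple
  have hmem : ∀ z ∈ closedBall lam₀ r, z ≠ lam₀ → z ∈ resolventSet A := by
    intro z hz hne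
    by_contra h
    exact hne (by simpa [hiso] using (show z ∈ closedBall lam₀ r ∩ spec A from ⟨hz, h⟩))
  obtain ⟨y₀, hy₀⟩ : ∃ y, g lam₀ y ≠ 0 := by
    by_contra! h
    exact hg0 (ContinuousLinearMap.ext h)
  set e := g lam₀ y₀
  have he : (e, lam₀ • e) ∈ A.graph := hker y₀
  obtain ⟨ψ, hψ⟩ : ∃ ψ : X →L[ℂ] ℂ, ψ e = 1 := by
    obtain ⟨l, -, hl⟩ := exists_dual_vector ℂ e (norm_ne_zero_iff.2 hy₀)
    refine ⟨(‖e‖ : ℂ)⁻¹ • l, ?_⟩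
    have : (‖e‖ : ℂ) ≠ 0 := by simpa using hy₀
    simp [hl, this]
  set φ : X →L[ℂ] ℂ := ψ.comp (g lam₀) with hφ
  have hφg : ∀ y, g lam₀ y = φ y • e := by
    intro y
    obtain ⟨c, hc⟩ := hsimple.exists_smul_eq
      (mem_genEigenspace_of_mem_kerPow (mem_kerPow_one he)) hy₀
      (mem_genEigenspace_of_mem_kerPow (mem_kerPow_one (hker y)))
    have : φ y = c := by
      rw [hφ, ContinuousLinearMap.comp_apply, ← hc, map_smul, hψ, smul_eq_mul, mul_one]
    rw [this, hc]
  have hgy : ∀ y, ContinuousAt (fun z => g z y) lam₀ := fun y =>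
    ((ContinuousLinearMap.apply ℂ X y).continuous.continuousAt).comp hg.continuousAt
  have hgraph : ∀ x a, (x, a) ∈ A.graph → g lam₀ (lam₀ • x - a) = 0 := by
    intro x a hxa
    have h1 : ∀ᶠ z in 𝓝[≠] lam₀, g z (z • x - a) = (z - lam₀) • x := by
      filter_upwards [hgeq, self_mem_nhdsWithin] with z hz hne
      have h2 := (isResolventAt_iff.1 (isResolventAt_resolvent hz.1)).2 x a hxa
      rw [hz.2, smul_apply] at h2
      rw [inv_smul_eq_iff₀ (sub_ne_zero.2 hne)] at h2
      exact h2
    have h3 : ContinuousAt (fun z => g z (z • x - a)) lam₀ :=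
      hg.continuousAt.clm_apply (by fun_prop)
    have := eq_of_eventuallyEq_punctured h3 (by fun_prop) h1
    simpa using this
  have hφA : ∀ x a, (x, a) ∈ A.graph → φ a = lam₀ * φ x := by
    intro x a hxa
    have h1 : φ (lam₀ • x - a) = 0 := by
      rw [hφ, ContinuousLinearMap.comp_apply, hgraph x a hxa, map_zero]
    rw [map_sub, map_smul, smul_eq_mul, sub_eq_zero] at h1
    exact h1.symm
  have hφe : φ e = 1 := by
    have h1 : ∀ᶠ z in 𝓝[≠] lam₀, g z e = e := by
      filter_upwards [hgeq, self_mem_nhdsWithin] with z hz hne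
      have h2 := (isResolventAt_iff.1 (isResolventAt_resolvent hz.1)).2 _ _ he
      rw [hz.2, ← sub_smul, map_smul, smul_apply, smul_smul,
        mul_inv_cancel₀ (sub_ne_zero.2 hne), one_smul] at h2
      exact h2
    have := eq_of_eventuallyEq_punctured (hgy e) continuousAt_const h1
    rw [hφ, ContinuousLinearMap.comp_apply, this, hψ]
  -- Near lam₀ the difference is the slope (g z - g lam₀) / (z - lam₀), so the right value at lam₀
  -- is the derivative of g.
  set H : ℂ → X →L[ℂ] X :=
    Function.update (fun z => resolvent A z - (z - lam₀)⁻¹ • g lam₀) lam₀ (deriv g lam₀) with hH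
  have hHne : ∀ z, z ≠ lam₀ → H z = resolvent A z - (z - lam₀)⁻¹ • g lam₀ := fun z hz =>
    Function.update_of_ne hz _ _
  have hHan0 : AnalyticAt ℂ H lam₀ := by
    have hd : AnalyticAt ℂ (dslope g lam₀) lam₀ := by
      obtain ⟨p, hp⟩ := hg
      exact (HasFPowerSeriesAt.has_fpower_series_dslope_fslope hp).analyticAt
    refine hd.congr ?_
    have h1 : ∀ᶠ z in 𝓝[≠] lam₀, dslope g lam₀ z = H z := by
      filter_upwards [hgeq, self_mem_nhdsWithin] with z hz hne
      rw [hHne z hne, dslope_of_ne _ hne, slope_def_module, hz.2, smul_sub]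
    rw [eventually_nhdsWithin_iff] at h1
    filter_upwards [h1] with z hz
    by_cases hne : z = lam₀
    · rw [hne, dslope_same, hH, Function.update_self]
    · exact hz hne
  have hHc : ∀ y, ContinuousAt (fun z => H z y) lam₀ := fun y =>
    ((ContinuousLinearMap.apply ℂ X y).continuous.continuousAt).comp hHan0.continuousAt
  have hφR : ∀ z ∈ resolventSet A, z ≠ lam₀ → ∀ y, φ (H z y) = 0 := by
    intro z hz hne y
    have h1 := hφA _ _ ((isResolventAt_iff.1 (isResolventAt_resolvent hz)).1 y)
    have h2 : z - lam₀ ≠ 0 := sub_ne_zero.2 hne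
    rw [map_sub, map_smul, smul_eq_mul] at h1
    rw [hHne z hne, sub_apply, smul_apply, hφg, map_sub, map_smul, map_smul, hφe]
    simp only [smul_eq_mul, mul_one]
    field_simp
    linear_combination h1
  have hright : ∀ z ∈ resolventSet A, z ≠ lam₀ → ∀ y,
      (H z y, z • H z y - (y - φ y • e)) ∈ A.graph := by
    intro z hz hne y
    have h1 := (isResolventAt_iff.1 (isResolventAt_resolvent hz)).1 y
    have h2 : z - lam₀ ≠ 0 := sub_ne_zero.2 hne
    have h3 := A.graph.sub_mem h1 (A.graph.smul_mem ((z - lam₀)⁻¹ * φ y) he)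
    rw [Prod.smul_mk, Prod.mk_sub_mk] at h3
    have h4 : H z y = resolvent A z y - ((z - lam₀)⁻¹ * φ y) • e := by
      rw [hHne z hne, sub_apply, smul_apply, hφg, smul_smul]
    rw [h4]
    convert h3 using 2
    have h5 : φ y • e = (z - lam₀) • (((z - lam₀)⁻¹ * φ y) • e) := by
      rw [smul_smul, mul_inv_cancel_left₀ h2]
    rw [h5, sub_smul, smul_sub, smul_comm lam₀]
    abel
  have hleft : ∀ z ∈ resolventSet A, z ≠ lam₀ → ∀ x a, (x, a) ∈ A.graph →
      H z (z • x - a) = x - φ x • e := by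
    intro z hz hne x a hxa
    have h1 := (isResolventAt_iff.1 (isResolventAt_resolvent hz)).2 x a hxa
    have h2 : z - lam₀ ≠ 0 := sub_ne_zero.2 hne
    rw [hHne z hne, sub_apply, smul_apply, h1, hφg, map_sub, map_smul, hφA x a hxa, smul_smul]
    congr 2
    rw [smul_eq_mul]
    field_simp
  have hevR : ∀ᶠ z in 𝓝[≠] lam₀, z ∈ resolventSet A ∧ z ≠ lam₀ := by
    filter_upwards [hgeq, self_mem_nhdsWithin] with z hz hne using ⟨hz.1, hne⟩
  refine ⟨e, φ, H, hφe, he, fun z hz => ?_, fun z hz y => ?_, fun z hz x a hxa => ?_,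
    fun z hz y => ?_, hφA⟩
  · by_cases hne : z = lam₀
    · rwa [hne]
    · have h2 : z - lam₀ ≠ 0 := sub_ne_zero.2 hne
      have h1 : AnalyticAt ℂ (fun z => resolvent A z - (z - lam₀)⁻¹ • g lam₀) z := by
        have := analyticAt_resolvent (hmem z hz hne)
        fun_prop (disch := assumption)
      refine h1.congr ?_
      filter_upwards [isOpen_ne.mem_nhds hne] with w hw
      exact (hHne w hw).symm
  · by_cases hne : z = lam₀
    · subst hne
      obtain ⟨z₀, hz₀⟩ := (hevR.mono fun z hz => hz.1).exists
      have hR₀ := isResolventAt_resolvent hz₀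
      -- The graph condition becomes an equation through the resolvent at an auxiliary point, so
      -- that the limit can be taken.
      rw [hR₀.mem_graph_iff]
      have hc := hHc y
      refine eq_of_eventuallyEq_punctured (f := fun z => resolvent A z₀ (z₀ • H z y -
        (z • H z y - (y - φ y • e)))) (g := fun z => H z y) (by fun_prop) hc ?_
      filter_upwards [hevR] with w hw
      exact hR₀.mem_graph_iff.1 (hright w hw.1 hw.2 y)
    · exact hright z (hmem z hz hne) hne y
  · by_cases hne : z = lam₀
    · subst hne
      refine eq_of_eventuallyEq_punctured (f := fun z => H z (z • x - a))
        (g := fun _ => x - φ x • e) (hHan0.continuousAt.clm_apply (by fun_prop))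
        continuousAt_const ?_
      filter_upwards [hevR] with w hw
      exact hleft w hw.1 hw.2 x a hxa
    · exact hleft z (hmem z hz hne) hne x a hxa
  · by_cases hne : z = lam₀
    · subst hne
      have hc := hHc y
      refine eq_of_eventuallyEq_punctured (f := fun z => φ (H z y)) (g := fun _ => 0)
        (by fun_prop) continuousAt_const ?_
      filter_upwards [hevR] with w hw
      exact hφR w hw.1 hw.2 y
    · exact hφR z (hmem z hz hne) hne y

end SimplePole

/-! ### Relatively bounded perturbation of a simple pole -/

section Reduction

theorem analyticAt_clm_apply {E F : Type*} [NormedAddCommGroup E] [NormedSpace ℂ E]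
    [NormedAddCommGroup F] [NormedSpace ℂ F] {f : ℂ → E →L[ℂ] F} {g : ℂ → E} {z : ℂ}
    (hf : AnalyticAt ℂ f z) (hg : AnalyticAt ℂ g z) : AnalyticAt ℂ (fun z => f z (g z)) z :=
  ((ContinuousLinearMap.id ℂ (E →L[ℂ] F)).analyticAt_bilinear (f z, g z)).comp₂ hf hg

variable {X : Type*} [NormedAddCommGroup X] [NormedSpace ℂ X]

/-- `(z₀ - A) H(z)`, where `H` is the regular part of the resolvent of `A`. -/
noncomputable def regularShift (z₀ : ℂ) (e : X) (φ : X →L[ℂ] ℂ) (H : ℂ → X →L[ℂ] X) (z : ℂ) :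
    X →L[ℂ] X :=
  (z₀ - z) • H z + (1 - φ.smulRight e)

/-- `(1 - B H(z))⁻¹`, where `B = C (z₀ - A)` on `dom(A)`. -/
noncomputable def neumannInv (z₀ : ℂ) (e : X) (φ : X →L[ℂ] ℂ) (H : ℂ → X →L[ℂ] X)
    (C : X →L[ℂ] X) (z : ℂ) : X →L[ℂ] X :=
  Ring.inverse (1 - C * regularShift z₀ e φ H z)

/-- `(1 - B H(z))⁻¹ B e`, where `B = C (z₀ - A)` on `dom(A)`. -/
noncomputable def reducedSource (z₀ lam₀ : ℂ) (e : X) (φ : X →L[ℂ] ℂ) (H : ℂ → X →L[ℂ] X)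
    (C : X →L[ℂ] X) (z : ℂ) : X :=
  neumannInv z₀ e φ H C z (C ((z₀ - lam₀) • e))

/-- The characteristic function whose zeros are the eigenvalues of the perturbed operator. -/
noncomputable def charFun (z₀ lam₀ : ℂ) (e : X) (φ : X →L[ℂ] ℂ) (H : ℂ → X →L[ℂ] X)
    (C : X →L[ℂ] X) (z : ℂ) : ℂ :=
  z - lam₀ - φ (reducedSource z₀ lam₀ e φ H C z)

/-- The vector that is an eigenvector of the perturbed operator at the zeros of `charFun`. -/
noncomputable def reducedVector (z₀ lam₀ : ℂ) (e : X) (φ : X →L[ℂ] ℂ) (H : ℂ → X →L[ℂ] X)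
    (C : X →L[ℂ] X) (z : ℂ) : X :=
  e + H z (reducedSource z₀ lam₀ e φ H C z)

/-- The functional `ψ` for which `x ↦ ψ(x) u` is the spectral projection onto the span of
`u = reducedVector`. -/
noncomputable def reducedFunctional (z₀ lam₀ : ℂ) (e : X) (φ : X →L[ℂ] ℂ) (H : ℂ → X →L[ℂ] X)
    (C : X →L[ℂ] X) (z : ℂ) : X →L[ℂ] ℂ :=
  (φ (neumannInv z₀ e φ H C z (reducedVector z₀ lam₀ e φ H C z)))⁻¹ •
    φ.comp (neumannInv z₀ e φ H C z)

variable {A A' : X →ₗ.[ℂ] X} {lam₀ : ℂ} {r : ℝ} {e : X} {φ : X →L[ℂ] ℂ} {H : ℂ → X →L[ℂ] X}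
  {z₀ z lam : ℂ} {C : X →L[ℂ] X}

/-- `A'` is the operator `A + C (z₀ - A)` with domain `dom(A)`. -/
def IsPerturbedBy (A A' : X →ₗ.[ℂ] X) (z₀ : ℂ) (C : X →L[ℂ] X) : Prop :=
  ∀ x y, (x, y) ∈ A'.graph ↔ ∃ a, (x, a) ∈ A.graph ∧ y = a + C (z₀ • x - a)

local notation "𝒢" => regularShift z₀ e φ H
local notation "ℳ" => neumannInv z₀ e φ H C
local notation "𝒷" => C ((z₀ - lam₀) • e)
local notation "𝓌" => reducedSource z₀ lam₀ e φ H C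
local notation "𝒟" => charFun z₀ lam₀ e φ H C
local notation "𝓊" => reducedVector z₀ lam₀ e φ H C

theorem neumannInv_apply (hU : IsUnit (1 - C * 𝒢 z)) (y : X) : ℳ z y = y + C (𝒢 z (ℳ z y)) := by
  have h := DFunLike.congr_fun (Ring.mul_inverse_cancel _ hU) y
  change ℳ z y - C (𝒢 z (ℳ z y)) = y at h
  rwa [sub_eq_iff_eq_add] at h

theorem neumannInv_apply_sub (hU : IsUnit (1 - C * 𝒢 z)) (y : X) :
    ℳ z (y - C (𝒢 z y)) = y :=
  DFunLike.congr_fun (Ring.inverse_mul_cancel _ hU) y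

theorem apply_reducedVector (hA : IsSimplePoleDecomposition A lam₀ r e φ H)
    (hz : z ∈ closedBall lam₀ r) : φ (𝓊 z) = 1 := by
  rw [reducedVector, map_add, hA.apply_eigenvector, hA.apply_regular z hz, add_zero]

/-- With v = M(z)(y + c Be) the vector is x = H(z)v + ce. Then (z - A)x = v - φ(v)e + c(z - lam₀)e
and Bx = v - y, so (z - A')x = y up to a multiple of e. The free scalar c can cancel that multiple
when D(z) ≠ 0; y = 0, c = 1 gives an eigenvector when D(z) = 0. -/
theorem mem_graph_perturbed (hA : IsSimplePoleDecomposition A lam₀ r e φ H)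
    (hA' : IsPerturbedBy A A' z₀ C) (hz : z ∈ closedBall lam₀ r) (hU : IsUnit (1 - C * 𝒢 z))
    (y : X) (c : ℂ) :
    (H z (ℳ z y) + c • 𝓊 z, z • (H z (ℳ z y) + c • 𝓊 z) - (y + (c * 𝒟 z - φ (ℳ z y)) • e)) ∈
      A'.graph := by
  set v := ℳ z (y + c • 𝒷) with hv
  have hv' : v = ℳ z y + c • 𝓌 z := by rw [hv, map_add, map_smul, reducedSource]
  have hx : H z (ℳ z y) + c • 𝓊 z = H z v + c • e := by
    rw [hv', map_add, map_smul, reducedVector, smul_add]; abel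
  rw [hx, hA']
  have h1 := A.graph.add_mem (hA.right_inv z hz v) (A.graph.smul_mem c hA.eigenvector)
  rw [Prod.smul_mk, Prod.mk_add_mk] at h1
  refine ⟨_, h1, ?_⟩
  have h2 : z₀ • (H z v + c • e) - (z • H z v - (v - φ v • e) + c • lam₀ • e) =
      𝒢 z v + c • (z₀ - lam₀) • e := by
    simp only [regularShift, add_apply, smul_apply, sub_apply, one_apply_eq_self,
      ContinuousLinearMap.smulRight_apply, sub_smul, smul_add, smul_sub]
    rw [smul_comm z₀ c]
    abel
  have h3 : C (𝒢 z v) = v - (y + c • 𝒷) := by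
    rw [eq_sub_iff_add_eq']
    exact (neumannInv_apply hU _).symm
  rw [h2, map_add, h3, map_smul C c, charFun]
  have h4 : φ v = φ (ℳ z y) + c * φ (𝓌 z) := by rw [hv', map_add, map_smul, smul_eq_mul]
  rw [h4]
  generalize C ((z₀ - lam₀) • e) = β
  simp only [smul_add, sub_smul, add_smul, mul_smul, mul_sub]
  rw [smul_comm z c]
  abel

/-- The converse reduction: c must be φ x, and solving (z - A')x = y forces the scalar equation
D(z)c = φ(M(z)y). Uniqueness, simplicity and the factorisation of D are all read off from it. -/
theorem eq_of_mem_graph_perturbed (hA : IsSimplePoleDecomposition A lam₀ r e φ H)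
    (hA' : IsPerturbedBy A A' z₀ C) (hz : z ∈ closedBall lam₀ r) (hU : IsUnit (1 - C * 𝒢 z))
    {x a' : X} (hx : (x, a') ∈ A'.graph) :
    x = H z (ℳ z (z • x - a')) + φ x • 𝓊 z ∧ 𝒟 z * φ x = φ (ℳ z (z • x - a')) := by
  obtain ⟨a, hxa, rfl⟩ := (hA' x a').1 hx
  set y := z • x - (a + C (z₀ • x - a)) with hy
  set v := z • x - a with hv
  have hvy : v = y + C (z₀ • x - a) := by rw [hv, hy]; abel
  have h1 : H z v = x - φ x • e := hA.left_inv z hz x a hxa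
  have hφv : φ v = (z - lam₀) * φ x := by
    rw [hv, map_sub, map_smul, hA.apply_graph x a hxa, smul_eq_mul, sub_mul]
  have h2 : z₀ • x - a = 𝒢 z v + φ x • (z₀ - lam₀) • e := by
    simp only [regularShift, add_apply, smul_apply, sub_apply, one_apply_eq_self,
      ContinuousLinearMap.smulRight_apply, h1, hφv]
    rw [hv]
    simp only [sub_smul, smul_sub, mul_smul, sub_mul]
    rw [smul_comm (φ x) z₀, smul_comm (φ x) lam₀]
    abel
  have h3 : v = ℳ z y + φ x • 𝓌 z := by
    have h4 := neumannInv_apply_sub hU v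
    have h5 : v - C (𝒢 z v) = y + φ x • 𝒷 := by
      rw [sub_eq_iff_eq_add]
      conv_lhs => rw [hvy, h2, map_add, map_smul]
      abel
    rw [h5, map_add, map_smul] at h4
    exact h4.symm
  constructor
  · have h6 : x = H z v + φ x • e := by rw [h1]; abel
    conv_lhs => rw [h6]
    rw [h3, map_add, map_smul, reducedVector, smul_add]
    abel
  · have h7 : φ v = φ (ℳ z y) + φ x * φ (𝓌 z) := by rw [h3, map_add, map_smul, smul_eq_mul]
    rw [charFun]
    linear_combination h7 - hφv

/-- The resolvent of the perturbed operator. -/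
theorem isResolventAt_perturbed (hA : IsSimplePoleDecomposition A lam₀ r e φ H)
    (hA' : IsPerturbedBy A A' z₀ C) (hz : z ∈ closedBall lam₀ r) (hU : IsUnit (1 - C * 𝒢 z))
    (hD : 𝒟 z ≠ 0) :
    IsResolventAt A' z (H z * ℳ z + (𝒟 z)⁻¹ • (φ.comp (ℳ z)).smulRight (𝓊 z)) := by
  have happ : ∀ y, (H z * ℳ z + (𝒟 z)⁻¹ • (φ.comp (ℳ z)).smulRight (𝓊 z)) y =
      H z (ℳ z y) + ((𝒟 z)⁻¹ * φ (ℳ z y)) • 𝓊 z := fun y => by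
    rw [mul_smul]; rfl
  rw [isResolventAt_iff]
  refine ⟨fun y => ?_, fun x a hx => ?_⟩
  · rw [happ]
    have := mem_graph_perturbed hA hA' hz hU y ((𝒟 z)⁻¹ * φ (ℳ z y))
    have h0 : (𝒟 z)⁻¹ * φ (ℳ z y) * 𝒟 z - φ (ℳ z y) = 0 := by field_simp; simp
    rwa [h0, zero_smul, add_zero] at this
  · obtain ⟨h1, h2⟩ := eq_of_mem_graph_perturbed hA hA' hz hU hx
    rw [happ, ← h2, inv_mul_cancel_left₀ hD]
    exact h1.symm

theorem reducedVector_mem_graph (hA : IsSimplePoleDecomposition A lam₀ r e φ H)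
    (hA' : IsPerturbedBy A A' z₀ C) (hz : z ∈ closedBall lam₀ r) (hU : IsUnit (1 - C * 𝒢 z))
    (hD : 𝒟 z = 0) : (𝓊 z, z • 𝓊 z) ∈ A'.graph := by
  have := mem_graph_perturbed hA hA' hz hU 0 1
  simpa [hD] using this

/-- At a zero of D this says Au = zu - w, so that w plays the role of Bu in the semigroup formulas;
`reducedSource_eq` expresses the same relation through C. -/
theorem reducedVector_mem_graph_unperturbed (hA : IsSimplePoleDecomposition A lam₀ r e φ H)
    (hz : z ∈ closedBall lam₀ r) (hD : 𝒟 z = 0) : (𝓊 z, z • 𝓊 z - 𝓌 z) ∈ A.graph := by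
  have h1 := A.graph.add_mem hA.eigenvector (hA.right_inv z hz (𝓌 z))
  rw [Prod.mk_add_mk, ← sub_eq_zero.1 hD] at h1
  have h2 : z • 𝓊 z - 𝓌 z = lam₀ • e + (z • H z (𝓌 z) - (𝓌 z - (z - lam₀) • e)) := by
    rw [reducedVector, smul_add, sub_smul]
    abel
  rwa [h2]

theorem reducedSource_eq (hU : IsUnit (1 - C * 𝒢 z)) (hD : 𝒟 z = 0) :
    𝓌 z = C (z₀ • 𝓊 z - (z • 𝓊 z - 𝓌 z)) := by
  have h1 : 𝓌 z = 𝒷 + C (𝒢 z (𝓌 z)) := neumannInv_apply hU _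
  have h2 : z₀ • 𝓊 z - (z • 𝓊 z - 𝓌 z) = (z₀ - lam₀) • e + 𝒢 z (𝓌 z) := by
    simp only [reducedVector, regularShift, add_apply, smul_apply, sub_apply, one_apply_eq_self,
      ContinuousLinearMap.smulRight_apply, ← sub_eq_zero.1 hD, sub_smul, smul_add]
    abel
  rw [h2, map_add, ← h1]

theorem mem_spec_perturbed_iff (hA : IsSimplePoleDecomposition A lam₀ r e φ H)
    (hA' : IsPerturbedBy A A' z₀ C) (hz : z ∈ closedBall lam₀ r) (hU : IsUnit (1 - C * 𝒢 z)) :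
    z ∈ spec A' ↔ 𝒟 z = 0 := by
  constructor
  · intro h
    by_contra hD
    exact h ⟨_, isResolventAt_perturbed hA hA' hz hU hD⟩
  · rintro hD ⟨R, hR⟩
    have h1 := (isResolventAt_iff.1 hR).2 _ _ (reducedVector_mem_graph hA hA' hz hU hD)
    rw [sub_self, map_zero] at h1
    have h2 := apply_reducedVector (C := C) (z₀ := z₀) hA hz
    rw [← h1, map_zero] at h2
    exact zero_ne_one h2

/-- The characteristic function factors at each of its zeros. -/
theorem charFun_eq_mul (hA : IsSimplePoleDecomposition A lam₀ r e φ H)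
    (hA' : IsPerturbedBy A A' z₀ C) (hlam : lam ∈ closedBall lam₀ r)
    (hUlam : IsUnit (1 - C * 𝒢 lam)) (hD : 𝒟 lam = 0)
    (hz : z ∈ closedBall lam₀ r) (hU : IsUnit (1 - C * 𝒢 z)) :
    𝒟 z = (z - lam) * φ (ℳ z (𝓊 lam)) := by
  -- The scalar equation at z is applied to x = u(lam), for which (z - A')x = (z - lam)x and φ x =
  -- 1.
  have h := (eq_of_mem_graph_perturbed hA hA' hz hU
    (reducedVector_mem_graph hA hA' hlam hUlam hD)).2
  rw [apply_reducedVector hA hlam, mul_one, ← sub_smul, map_smul, map_smul, smul_eq_mul] at h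
  exact h

/-- No Jordan chain can start: if (lam - A')x = cu, the scalar equation reads 0 = c φ(M(lam)u), so c
= 0, and then x = φ(x)u. -/
theorem isAlgSimple_perturbed (hA : IsSimplePoleDecomposition A lam₀ r e φ H)
    (hA' : IsPerturbedBy A A' z₀ C) (hlam : lam ∈ closedBall lam₀ r)
    (hU : IsUnit (1 - C * 𝒢 lam)) (hD : 𝒟 lam = 0) (hd : φ (ℳ lam (𝓊 lam)) ≠ 0) :
    IsAlgSimple A' lam := by
  have hu0 : 𝓊 lam ≠ 0 := by
    intro h
    have h2 := apply_reducedVector (C := C) (z₀ := z₀) hA hlam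
    rw [h, map_zero] at h2
    exact zero_ne_one h2
  have hle : ∀ m, kerPow A' lam m ≤ Submodule.span ℂ {𝓊 lam} := by
    intro m
    induction m with
    | zero => exact bot_le
    | succ m ih =>
      intro x hx
      obtain ⟨a, hxa, hmem⟩ := mem_kerPow_succ.1 hx
      obtain ⟨c, hc⟩ := Submodule.mem_span_singleton.1 (ih hmem)
      obtain ⟨h1, h2⟩ := eq_of_mem_graph_perturbed hA hA' hlam hU hxa
      rw [← hc, map_smul, map_smul, hD, zero_mul, smul_eq_mul] at h2
      have hc0 : c = 0 := (mul_eq_zero.1 h2.symm).resolve_right hd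
      rw [← hc, hc0, zero_smul, map_zero, map_zero, zero_add] at h1
      rw [h1]
      exact Submodule.smul_mem _ _ (Submodule.mem_span_singleton_self _)
  have heq : genEigenspace A' lam = Submodule.span ℂ {𝓊 lam} := by
    refine le_antisymm (iSup_le hle) ?_
    rw [Submodule.span_singleton_le_iff_mem]
    exact mem_genEigenspace_of_mem_kerPow
      (mem_kerPow_one (reducedVector_mem_graph hA hA' hlam hU hD))
  rw [IsAlgSimple, heq]
  exact finrank_span_singleton hu0

theorem analyticAt_regularShift (hA : IsSimplePoleDecomposition A lam₀ r e φ H)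
    (hz : z ∈ closedBall lam₀ r) : AnalyticAt ℂ 𝒢 z := by
  have h := hA.analytic z hz
  have h1 : AnalyticAt ℂ (fun z : ℂ => z₀ - z) z := by fun_prop
  exact (h1.smul h).add analyticAt_const

variable [CompleteSpace X]

theorem analyticAt_neumannInv (hA : IsSimplePoleDecomposition A lam₀ r e φ H)
    (hz : z ∈ closedBall lam₀ r) (hU : IsUnit (1 - C * 𝒢 z)) : AnalyticAt ℂ ℳ z := by
  obtain ⟨S, hS⟩ := hU
  have h1 := analyticAt_inverse (𝕜 := ℂ) S
  rw [hS] at h1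
  exact AnalyticAt.comp (f := fun z => 1 - C * 𝒢 z) h1
    (analyticAt_const.sub (analyticAt_const.mul (analyticAt_regularShift hA hz)))

theorem analyticAt_reducedSource (hA : IsSimplePoleDecomposition A lam₀ r e φ H)
    (hz : z ∈ closedBall lam₀ r) (hU : IsUnit (1 - C * 𝒢 z)) : AnalyticAt ℂ 𝓌 z :=
  analyticAt_clm_apply (analyticAt_neumannInv hA hz hU) analyticAt_const

theorem analyticAt_reducedVector (hA : IsSimplePoleDecomposition A lam₀ r e φ H)
    (hz : z ∈ closedBall lam₀ r) (hU : IsUnit (1 - C * 𝒢 z)) : AnalyticAt ℂ 𝓊 z :=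
  analyticAt_const.add (analyticAt_clm_apply (hA.analytic z hz) (analyticAt_reducedSource hA hz hU))

theorem analyticAt_smulRight (hA : IsSimplePoleDecomposition A lam₀ r e φ H)
    (hz : z ∈ closedBall lam₀ r) (hU : IsUnit (1 - C * 𝒢 z)) :
    AnalyticAt ℂ (fun z => (φ.comp (ℳ z)).smulRight (𝓊 z)) z := by
  have h1 : AnalyticAt ℂ (fun z => φ.comp (ℳ z)) z :=
    ((ContinuousLinearMap.compL ℂ X X ℂ φ).analyticAt _).comp (analyticAt_neumannInv hA hz hU)
  have h2 : AnalyticAt ℂ (fun z => ContinuousLinearMap.smulRightL ℂ X X (φ.comp (ℳ z))) z :=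
    ((ContinuousLinearMap.smulRightL ℂ X X).analyticAt _).comp h1
  exact analyticAt_clm_apply h2 (analyticAt_reducedVector hA hz hU)

/-- The explicit resolvent is meromorphic. If its order at lam were nonnegative it would have a
limit there, contradicting (z - lam)R(z)u = u ≠ 0. -/
theorem isResolventPole_perturbed (hA : IsSimplePoleDecomposition A lam₀ r e φ H)
    (hA' : IsPerturbedBy A A' z₀ C) (hU : ∀ z ∈ closedBall lam₀ r, IsUnit (1 - C * 𝒢 z))
    (hlam : lam ∈ ball lam₀ r) (hD : 𝒟 lam = 0)
    (hne : ∀ z ∈ closedBall lam₀ r, z ≠ lam → 𝒟 z ≠ 0) : IsResolventPole A' lam := by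
  have hlam' := ball_subset_closedBall hlam
  have hev : ∀ᶠ z in 𝓝[≠] lam, z ∈ closedBall lam₀ r ∧ z ≠ lam := by
    filter_upwards [self_mem_nhdsWithin, nhdsWithin_le_nhds (isOpen_ball.mem_nhds hlam)] with z h1 h2
    exact ⟨ball_subset_closedBall h2, h1⟩
  have hres : ∀ᶠ z in 𝓝[≠] lam, IsResolventAt A' z
      (H z * ℳ z + (𝒟 z)⁻¹ • (φ.comp (ℳ z)).smulRight (𝓊 z)) := by
    filter_upwards [hev] with z hz
    exact isResolventAt_perturbed hA hA' hz.1 (hU z hz.1) (hne z hz.1 hz.2)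
  have hmer : MeromorphicAt (resolvent A') lam := by
    have hH := (hA.analytic lam hlam').meromorphicAt
    have hM := (analyticAt_neumannInv hA hlam' (hU lam hlam')).meromorphicAt
    have hDm : MeromorphicAt 𝒟 lam := by
      have h1 : AnalyticAt ℂ (fun z => φ (𝓌 z)) lam :=
        (φ.analyticAt _).comp (analyticAt_reducedSource hA hlam' (hU lam hlam'))
      have h2 : AnalyticAt ℂ (fun z : ℂ => z - lam₀) lam := by fun_prop
      exact (h2.sub h1).meromorphicAt
    have hK := (analyticAt_smulRight hA hlam' (hU lam hlam')).meromorphicAt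
    refine (((hA.analytic lam hlam').mul
      (analyticAt_neumannInv hA hlam' (hU lam hlam'))).meromorphicAt.add
        (hDm.inv.smul hK)).congr ?_
    filter_upwards [hres] with z hz
    exact hz.resolvent_eq.symm
  refine ⟨(mem_spec_perturbed_iff hA hA' hlam' (hU lam hlam')).2 hD, ?_, hmer, ?_⟩
  · filter_upwards [hres] with z hz using ⟨_, hz⟩
  · by_contra hord
    obtain ⟨c, hc⟩ := (tendsto_nhds_iff_meromorphicOrderAt_nonneg hmer).2 (not_lt.1 hord)
    have h1 : Tendsto (fun z => (z - lam) • resolvent A' z (𝓊 lam)) (𝓝[≠] lam)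
        (𝓝 ((lam - lam) • c (𝓊 lam))) := by
      refine Tendsto.smul ?_ ?_
      · exact (tendsto_id.sub_const lam).mono_left nhdsWithin_le_nhds
      · exact ((ContinuousLinearMap.apply ℂ X (𝓊 lam)).continuous.tendsto c).comp hc
    have h2 : ∀ᶠ z in 𝓝[≠] lam, (z - lam) • resolvent A' z (𝓊 lam) = 𝓊 lam := by
      filter_upwards [hres] with z hz
      have h3 := (isResolventAt_iff.1 hz).2 _ _
        (reducedVector_mem_graph hA hA' hlam' (hU lam hlam') hD)
      rw [← hz.resolvent_eq, ← sub_smul, map_smul] at h3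
      exact h3
    have h4 : 𝓊 lam = 0 := by
      have := tendsto_nhds_unique (h1.congr' h2) tendsto_const_nhds
      simpa using this.symm
    have h5 := apply_reducedVector (C := C) (z₀ := z₀) hA hlam'
    rw [h4, map_zero] at h5
    exact zero_ne_one h5

/-- After the factorisation of D the resolvent is H M + (z - lam)⁻¹ K(z) with K analytic. Cauchy's
theorem removes the first term, and Cauchy's formula returns K(lam). -/
theorem isSpectralProjection_perturbed (hA : IsSimplePoleDecomposition A lam₀ r e φ H)
    (hA' : IsPerturbedBy A A' z₀ C) (hU : ∀ z ∈ closedBall lam₀ r, IsUnit (1 - C * 𝒢 z))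
    (hlam : lam ∈ ball lam₀ r) (hD : 𝒟 lam = 0)
    (hd : ∀ z ∈ closedBall lam₀ r, φ (ℳ z (𝓊 lam)) ≠ 0) :
    IsSpectralProjection A' lam
      ((reducedFunctional z₀ lam₀ e φ H C lam).smulRight (𝓊 lam)) := by
  have hlam' := ball_subset_closedBall hlam
  have hfac : ∀ z ∈ closedBall lam₀ r, 𝒟 z = (z - lam) * φ (ℳ z (𝓊 lam)) := fun z hz =>
    charFun_eq_mul hA hA' hlam' (hU lam hlam') hD hz (hU z hz)
  obtain ⟨ε, hε, hεsub⟩ := nhds_basis_closedBall.mem_iff.1 (isOpen_ball.mem_nhds hlam)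
  have hsub : closedBall lam ε ⊆ closedBall lam₀ r := hεsub.trans ball_subset_closedBall
  refine ⟨ε, hε, ?_, ?_⟩
  · ext z
    simp only [mem_inter_iff, mem_singleton_iff]
    constructor
    · rintro ⟨hz, hzs⟩
      have h1 := (mem_spec_perturbed_iff hA hA' (hsub hz) (hU z (hsub hz))).1 hzs
      rw [hfac z (hsub hz)] at h1
      exact sub_eq_zero.1 ((mul_eq_zero.1 h1).resolve_right (hd z (hsub hz)))
    · rintro rfl
      exact ⟨mem_closedBall_self hε.le, (mem_spec_perturbed_iff hA hA' hlam' (hU z hlam')).2 hD⟩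
  · set K : ℂ → X →L[ℂ] X :=
      fun z => (φ (ℳ z (𝓊 lam)))⁻¹ • (φ.comp (ℳ z)).smulRight (𝓊 z) with hK
    have hKd : DifferentiableOn ℂ K (closedBall lam ε) := fun z hz => by
      have h1 : AnalyticAt ℂ (fun z => φ (ℳ z (𝓊 lam))) z :=
        AnalyticAt.comp (g := φ) (f := fun z => ℳ z (𝓊 lam)) (φ.analyticAt _)
          (analyticAt_clm_apply (analyticAt_neumannInv hA (hsub hz) (hU z (hsub hz))) analyticAt_const)
      exact ((h1.inv (hd z (hsub hz))).smul
        (analyticAt_smulRight hA (hsub hz) (hU z (hsub hz)))).differentiableAt.differentiableWithinAt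
    have hHM : DifferentiableOn ℂ (fun z => H z * ℳ z) (closedBall lam ε) := fun z hz =>
      ((hA.analytic z (hsub hz)).mul (analyticAt_neumannInv hA (hsub hz)
        (hU z (hsub hz)))).differentiableAt.differentiableWithinAt
    have hEq : EqOn (resolvent A') (fun z => H z * ℳ z + (z - lam)⁻¹ • K z) (sphere lam ε) := by
      intro z hz
      have hz' := hsub (sphere_subset_closedBall hz)
      have hne : z ≠ lam := by
        rintro rfl
        simp only [mem_sphere, dist_self] at hz
        exact hε.ne hz
      have hDne : 𝒟 z ≠ 0 := by
        rw [hfac z hz']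
        exact mul_ne_zero (sub_ne_zero.2 hne) (hd z hz')
      rw [(isResolventAt_perturbed hA hA' hz' (hU z hz') hDne).resolvent_eq, hfac z hz', mul_inv,
        mul_smul]
    have hzc : ContinuousOn (fun z : ℂ => (z - lam)⁻¹) (sphere lam ε) := by
      refine (continuousOn_id.sub continuousOn_const).inv₀ fun z hz => sub_ne_zero.2 ?_
      rintro rfl
      simp only [mem_sphere, id, dist_self] at hz
      exact hε.ne hz
    rw [circleIntegral.integral_congr hε.le hEq, circleIntegral.integral_add
      ((hHM.continuousOn.mono sphere_subset_closedBall).circleIntegrable hε.le)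
      ((hzc.fun_smul (hKd.continuousOn.mono sphere_subset_closedBall)).circleIntegrable hε.le),
      hKd.circleIntegral_sub_inv_smul (mem_ball_self hε)]
    rw [Complex.circleIntegral_eq_zero_of_differentiable_on_off_countable hε.le countable_empty
      hHM.continuousOn fun z hz => (hHM.differentiableAt (closedBall_mem_nhds_of_mem hz.1)),
      zero_add, smul_smul, inv_mul_cancel₀, one_smul]
    · ext x
      simp [reducedFunctional, hK, mul_smul]
    · simp [Real.pi_ne_zero, Complex.I_ne_zero]

end Reduction

/-! ### Holomorphic dependence of the perturbed eigenvalue -/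

section Dependence

variable {X : Type*} [NormedAddCommGroup X] [NormedSpace ℂ X] [CompleteSpace X]
  {A : X →ₗ.[ℂ] X} {lam₀ : ℂ} {r : ℝ} {e : X} {φ : X →L[ℂ] ℂ} {H : ℂ → X →L[ℂ] X} {z₀ : ℂ}

/-- The perturbation `C` is so small that the reduction applies on all of `closedBall lam₀ r` and
the characteristic equation is a contractive fixed point equation. -/
structure IsSmallPerturbation (z₀ lam₀ : ℂ) (r : ℝ) (e : X) (φ : X →L[ℂ] ℂ) (H : ℂ → X →L[ℂ] X)
    (C : X →L[ℂ] X) : Prop where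
  isUnit : ∀ z ∈ closedBall lam₀ r, IsUnit (1 - C * regularShift z₀ e φ H z)
  norm_le : ∀ z ∈ closedBall lam₀ r, ‖φ (reducedSource z₀ lam₀ e φ H C z)‖ ≤ r / 2
  lipschitz : ∀ z ∈ closedBall lam₀ r, ∀ z' ∈ closedBall lam₀ r,
    ‖φ (reducedSource z₀ lam₀ e φ H C z) - φ (reducedSource z₀ lam₀ e φ H C z')‖ ≤
      1 / 2 * ‖z - z'‖
  ne_zero : ∀ z ∈ closedBall lam₀ r, ∀ z' ∈ closedBall lam₀ r,
    φ (neumannInv z₀ e φ H C z (reducedVector z₀ lam₀ e φ H C z')) ≠ 0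

theorem exists_bound_regularShift (hA : IsSimplePoleDecomposition A lam₀ r e φ H) (z₀ : ℂ) :
    ∃ K L : ℝ, 0 ≤ K ∧ 0 ≤ L ∧ (∀ z ∈ closedBall lam₀ r, ‖regularShift z₀ e φ H z‖ ≤ K) ∧
      (∀ z ∈ closedBall lam₀ r, ‖H z‖ ≤ K) ∧
      ∀ z ∈ closedBall lam₀ r, ∀ z' ∈ closedBall lam₀ r,
        ‖regularShift z₀ e φ H z - regularShift z₀ e φ H z'‖ ≤ L * ‖z - z'‖ := by
  have hG : AnalyticOnNhd ℂ (regularShift z₀ e φ H) (closedBall lam₀ r) := fun z hz =>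
    analyticAt_regularShift hA hz
  obtain ⟨K₁, hK₁⟩ := (isCompact_closedBall lam₀ r).exists_bound_of_continuousOn hG.continuousOn
  obtain ⟨K₂, hK₂⟩ := (isCompact_closedBall lam₀ r).exists_bound_of_continuousOn
    hA.analytic.continuousOn
  obtain ⟨L, hL⟩ := (isCompact_closedBall lam₀ r).exists_bound_of_continuousOn
    hG.deriv.continuousOn
  refine ⟨max 0 (max K₁ K₂), max 0 L, le_max_left _ _, le_max_left _ _,
    fun z hz => (hK₁ z hz).trans (by simp), fun z hz => (hK₂ z hz).trans (by simp),
    fun z hz z' hz' => ?_⟩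
  exact (convex_closedBall lam₀ r).norm_image_sub_le_of_norm_deriv_le
    (fun v hv => (hG v hv).differentiableAt) (fun v hv => (hL v hv).trans (le_max_right _ _)) hz' hz

theorem exists_isSmallPerturbation (hA : IsSimplePoleDecomposition A lam₀ r e φ H) (z₀ : ℂ)
    (hr : 0 < r) :
    ∃ ε > 0, ∀ C : X →L[ℂ] X, ‖C‖ < ε → IsSmallPerturbation z₀ lam₀ r e φ H C := by
  obtain ⟨K, L, hK0, hL0, hG, hH, hLip⟩ := exists_bound_regularShift hA z₀
  set Z := ‖(z₀ - lam₀) • e‖ with hZ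
  -- Here c stands for ‖C‖. The conditions ensure, in order: ‖M(z)‖ ≤ 2 by a Neumann series; |φ(w)|
  -- ≤ r / 2; Lipschitz constant 1 / 2 of φ ∘ w; and |φ(M(z)u(z')) - 1| < 1, whence that number is
  -- nonzero.
  have hev : ∀ᶠ c in 𝓝 (0 : ℝ), c * K < 1 / 2 ∧ ‖φ‖ * (2 * (c * Z)) < r / 2 ∧
      ‖φ‖ * (2 * (c * L * (2 * (c * Z)))) < 1 / 2 ∧
      ‖φ‖ * (c * (K * (2 * (‖e‖ + K * (2 * (c * Z)))))) < 1 := by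
    refine (ContinuousAt.eventually_lt (by fun_prop) continuousAt_const (by norm_num)).and
      ((ContinuousAt.eventually_lt (by fun_prop) continuousAt_const (by simpa using hr)).and
      ((ContinuousAt.eventually_lt (by fun_prop) continuousAt_const (by simp)).and
      (ContinuousAt.eventually_lt (by fun_prop) continuousAt_const (by simp))))
  obtain ⟨ε, hε, hεc⟩ := Metric.eventually_nhds_iff.1 hev
  refine ⟨ε, hε, fun C hC => ?_⟩
  set c := ‖C‖ with hc
  have hc0 : 0 ≤ c := norm_nonneg C
  obtain ⟨h1, h2, h3, h4⟩ := hεc (y := c) (by simpa [abs_of_nonneg hc0] using hC)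
  have hCG : ∀ z ∈ closedBall lam₀ r, ∀ x, ‖C (regularShift z₀ e φ H z x)‖ ≤ c * (K * ‖x‖) :=
    fun z hz x => (C.le_opNorm _).trans (mul_le_mul_of_nonneg_left
      (ContinuousLinearMap.le_of_opNorm_le _ (hG z hz) x) hc0)
  have hU : ∀ z ∈ closedBall lam₀ r, IsUnit (1 - C * regularShift z₀ e φ H z) := fun z hz => by
    refine isUnit_one_sub_of_norm_lt_one ((norm_mul_le _ _).trans_lt ?_)
    have := mul_le_mul_of_nonneg_left (hG z hz) hc0
    linarith
  have hM : ∀ z ∈ closedBall lam₀ r, ∀ x, ‖neumannInv z₀ e φ H C z x‖ ≤ 2 * ‖x‖ := by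
    intro z hz x
    have h5 := neumannInv_apply (hU z hz) x
    have h6 := hCG z hz (neumannInv z₀ e φ H C z x)
    have h7 := norm_add_le x (C (regularShift z₀ e φ H z (neumannInv z₀ e φ H C z x)))
    rw [← h5] at h7
    nlinarith [norm_nonneg (neumannInv z₀ e φ H C z x)]
  have hb : ‖C ((z₀ - lam₀) • e)‖ ≤ c * Z := C.le_opNorm _
  have hw : ∀ z ∈ closedBall lam₀ r, ‖reducedSource z₀ lam₀ e φ H C z‖ ≤ 2 * (c * Z) :=
    fun z hz => (hM z hz _).trans (by linarith)
  refine ⟨hU, fun z hz => ?_, fun z hz z' hz' => ?_, fun z hz z' hz' h0 => ?_⟩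
  · exact ((φ.le_opNorm _).trans (mul_le_mul_of_nonneg_left (hw z hz) (norm_nonneg _))).trans h2.le
  · rw [← map_sub]
    set m := reducedSource z₀ lam₀ e φ H C z with hm
    set m' := reducedSource z₀ lam₀ e φ H C z' with hm'
    have e1 : m = C ((z₀ - lam₀) • e) + C (regularShift z₀ e φ H z m) := neumannInv_apply (hU z hz) _
    have e2 : m' = C ((z₀ - lam₀) • e) + C (regularShift z₀ e φ H z' m') :=
      neumannInv_apply (hU z' hz') _
    -- Difference of the fixed point equations w = Be + BH(z)w at z and z'; the first term on the
    -- right is absorbed into the left side, as c * K < 1 / 2.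
    have e3 : m - m' = C (regularShift z₀ e φ H z (m - m')) +
        C ((regularShift z₀ e φ H z - regularShift z₀ e φ H z') m') := by
      conv_lhs => rw [e1, e2]
      simp only [map_sub, sub_apply]
      abel
    have e4 := norm_add_le (C (regularShift z₀ e φ H z (m - m')))
      (C ((regularShift z₀ e φ H z - regularShift z₀ e φ H z') m'))
    rw [← e3] at e4
    have e5 := hCG z hz (m - m')
    have e6 : ‖C ((regularShift z₀ e φ H z - regularShift z₀ e φ H z') m')‖ ≤
        c * (L * ‖z - z'‖ * (2 * (c * Z))) := by
      refine (C.le_opNorm _).trans (mul_le_mul_of_nonneg_left ?_ hc0)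
      refine (ContinuousLinearMap.le_opNorm _ _).trans ?_
      exact mul_le_mul (hLip z hz z' hz') (hw z' hz') (norm_nonneg _) (by positivity)
    have e7 : ‖m - m'‖ ≤ 2 * (c * L * (2 * (c * Z))) * ‖z - z'‖ := by
      nlinarith [norm_nonneg (m - m')]
    calc ‖φ (m - m')‖ ≤ ‖φ‖ * ‖m - m'‖ := φ.le_opNorm _
      _ ≤ ‖φ‖ * (2 * (c * L * (2 * (c * Z))) * ‖z - z'‖) :=
        mul_le_mul_of_nonneg_left e7 (norm_nonneg _)
      _ = ‖φ‖ * (2 * (c * L * (2 * (c * Z)))) * ‖z - z'‖ := by ring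
      _ ≤ _ := mul_le_mul_of_nonneg_right h3.le (norm_nonneg _)
  · set v := reducedVector z₀ lam₀ e φ H C z' with hv
    have hv1 : ‖v‖ ≤ ‖e‖ + K * (2 * (c * Z)) := by
      refine (norm_add_le _ _).trans (add_le_add le_rfl ?_)
      refine (ContinuousLinearMap.le_opNorm _ _).trans ?_
      exact mul_le_mul (hH z' hz') (hw z' hz') (norm_nonneg _) hK0
    rw [neumannInv_apply (hU z hz) v, map_add, hv, apply_reducedVector hA hz', ← hv] at h0
    have h5 : ‖φ (C (regularShift z₀ e φ H z (neumannInv z₀ e φ H C z v)))‖ < 1 := by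
      refine lt_of_le_of_lt ?_ h4
      refine (φ.le_opNorm _).trans (mul_le_mul_of_nonneg_left ?_ (norm_nonneg _))
      refine (hCG z hz _).trans (mul_le_mul_of_nonneg_left
        (mul_le_mul_of_nonneg_left ?_ hK0) hc0)
      exact (hM z hz v).trans (by linarith)
    rw [eq_neg_of_add_eq_zero_right h0, norm_neg, norm_one] at h5
    exact lt_irrefl _ h5

variable {C : ℂ → X →L[ℂ] X} {μ : ℂ → ℂ} {κ : ℂ}

theorem differentiableAt_neumannInv (hA : IsSimplePoleDecomposition A lam₀ r e φ H)
    (hC : DifferentiableAt ℂ C κ) (hμ : DifferentiableAt ℂ μ κ) (hμr : μ κ ∈ closedBall lam₀ r)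
    (hU : IsUnit (1 - C κ * regularShift z₀ e φ H (μ κ))) :
    DifferentiableAt ℂ (fun κ => neumannInv z₀ e φ H (C κ) (μ κ)) κ := by
  have h1 : DifferentiableAt ℂ (fun κ => regularShift z₀ e φ H (μ κ)) κ :=
    (analyticAt_regularShift hA hμr).differentiableAt.comp κ hμ
  have h2 : DifferentiableAt ℂ (fun κ => 1 - C κ * regularShift z₀ e φ H (μ κ)) κ :=
    (hC.mul h1).const_sub 1
  exact (differentiableAt_inverse (𝕜 := ℂ) hU).comp κ h2

theorem differentiableAt_reducedSource (hA : IsSimplePoleDecomposition A lam₀ r e φ H)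
    (hC : DifferentiableAt ℂ C κ) (hμ : DifferentiableAt ℂ μ κ) (hμr : μ κ ∈ closedBall lam₀ r)
    (hU : IsUnit (1 - C κ * regularShift z₀ e φ H (μ κ))) :
    DifferentiableAt ℂ (fun κ => reducedSource z₀ lam₀ e φ H (C κ) (μ κ)) κ :=
  (differentiableAt_neumannInv hA hC hμ hμr hU).clm_apply
    (hC.clm_apply (differentiableAt_const _))

theorem differentiableAt_reducedVector (hA : IsSimplePoleDecomposition A lam₀ r e φ H)
    (hC : DifferentiableAt ℂ C κ) (hμ : DifferentiableAt ℂ μ κ) (hμr : μ κ ∈ closedBall lam₀ r)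
    (hU : IsUnit (1 - C κ * regularShift z₀ e φ H (μ κ))) :
    DifferentiableAt ℂ (fun κ => reducedVector z₀ lam₀ e φ H (C κ) (μ κ)) κ :=
  (((hA.analytic _ hμr).differentiableAt.comp κ hμ).clm_apply
    (differentiableAt_reducedSource hA hC hμ hμr hU)).const_add e

theorem differentiableAt_reducedFunctional (hA : IsSimplePoleDecomposition A lam₀ r e φ H)
    (hC : DifferentiableAt ℂ C κ) (hμ : DifferentiableAt ℂ μ κ) (hμr : μ κ ∈ closedBall lam₀ r)
    (hU : IsUnit (1 - C κ * regularShift z₀ e φ H (μ κ)))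
    (hne : φ (neumannInv z₀ e φ H (C κ) (μ κ) (reducedVector z₀ lam₀ e φ H (C κ) (μ κ))) ≠ 0) :
    DifferentiableAt ℂ (fun κ => reducedFunctional z₀ lam₀ e φ H (C κ) (μ κ)) κ := by
  have h1 := differentiableAt_neumannInv hA hC hμ hμr hU
  have h2 := differentiableAt_reducedVector hA hC hμ hμr hU
  have h3 : DifferentiableAt ℂ (fun κ => φ (neumannInv z₀ e φ H (C κ) (μ κ)
      (reducedVector z₀ lam₀ e φ H (C κ) (μ κ)))) κ :=
    φ.differentiableAt.comp κ (h1.clm_apply h2)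
  exact (h3.inv hne).smul ((differentiableAt_const φ).clm_comp h1)

/-- The perturbed eigenvalue as a holomorphic function of the parameter. -/
theorem exists_differentiableOn_zero_charFun (hA : IsSimplePoleDecomposition A lam₀ r e φ H)
    (hr : 0 < r) {U : Set ℂ} (hU : IsOpen U) (hC : DifferentiableOn ℂ C U)
    (hsmall : ∀ κ ∈ U, IsSmallPerturbation z₀ lam₀ r e φ H (C κ)) :
    ∃ lam : ℂ → ℂ, DifferentiableOn ℂ lam U ∧
      ∀ κ ∈ U, lam κ ∈ ball lam₀ r ∧ charFun z₀ lam₀ e φ H (C κ) (lam κ) = 0 := by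
  -- Zeros of the characteristic function are the fixed points of f κ. Starting at lam₀, the
  -- iterates are holomorphic in κ, and the contraction ratio 1 / 2 does not depend on κ, so
  -- convergence is uniform.
  set f : ℂ → ℂ → ℂ := fun κ l => lam₀ + φ (reducedSource z₀ lam₀ e φ H (C κ) l) with hf
  set p : ℕ → ℂ → ℂ := fun n κ => (f κ)^[n] lam₀ with hp
  have hps : ∀ n κ, p (n + 1) κ = f κ (p n κ) := fun n κ => Function.iterate_succ_apply' _ _ _
  have hmaps : ∀ κ ∈ U, ∀ l ∈ closedBall lam₀ r, f κ l ∈ closedBall lam₀ (r / 2) := by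
    intro κ hκ l hl
    simpa [hf, mem_closedBall, dist_eq_norm] using (hsmall κ hκ).norm_le l hl
  have hhalf : closedBall lam₀ (r / 2) ⊆ closedBall lam₀ r :=
    closedBall_subset_closedBall (by linarith)
  have hpm : ∀ κ ∈ U, ∀ n, p n κ ∈ closedBall lam₀ (r / 2) := by
    intro κ hκ n
    induction n with
    | zero => exact mem_closedBall_self (by positivity)
    | succ n ih => rw [hps]; exact hmaps κ hκ _ (hhalf ih)
  have hdist : ∀ κ ∈ U, ∀ n, dist (p n κ) (p (n + 1) κ) ≤ r / 2 * (1 / 2) ^ n := by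
    intro κ hκ n
    induction n with
    | zero =>
      have := hpm κ hκ 1
      rw [mem_closedBall, dist_comm] at this
      rw [pow_zero, mul_one]
      exact this
    | succ n ih =>
      have h1 := (hsmall κ hκ).lipschitz _ (hhalf (hpm κ hκ n)) _ (hhalf (hpm κ hκ (n + 1)))
      have h2 : p (n + 1) κ - p (n + 1 + 1) κ = φ (reducedSource z₀ lam₀ e φ H (C κ) (p n κ)) -
          φ (reducedSource z₀ lam₀ e φ H (C κ) (p (n + 1) κ)) := by
        rw [hps n, hps (n + 1), hps n]
        exact add_sub_add_left_eq_sub _ _ _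
      rw [dist_eq_norm] at ih ⊢
      rw [h2, pow_succ]
      linarith
  have hlim : ∀ κ ∈ U, ∃ l, Tendsto (fun n => p n κ) atTop (𝓝 l) := fun κ hκ =>
    cauchySeq_tendsto_of_complete (cauchySeq_of_le_geometric _ _ (by norm_num) (hdist κ hκ))
  choose! lam hlam using hlim
  have hmem : ∀ κ ∈ U, lam κ ∈ closedBall lam₀ (r / 2) := fun κ hκ =>
    isClosed_closedBall.mem_of_tendsto (hlam κ hκ) (Eventually.of_forall (hpm κ hκ))
  refine ⟨lam, ?_, fun κ hκ => ⟨closedBall_subset_ball (by linarith) (hmem κ hκ), ?_⟩⟩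
  · have hpd : ∀ n, DifferentiableOn ℂ (p n) U := by
      intro n
      induction n with
      | zero => exact differentiableOn_const _
      | succ n ih =>
        intro κ hκ
        have h1 := differentiableAt_reducedSource (z₀ := z₀) hA
          (hC.differentiableAt (hU.mem_nhds hκ)) (ih.differentiableAt (hU.mem_nhds hκ))
          (hhalf (hpm κ hκ n)) ((hsmall κ hκ).isUnit _ (hhalf (hpm κ hκ n)))
        have h2 : DifferentiableAt ℂ (p (n + 1)) κ := by
          have : p (n + 1) = fun κ => lam₀ + φ (reducedSource z₀ lam₀ e φ H (C κ) (p n κ)) :=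
            funext fun κ => hps n κ
          rw [this]
          exact (φ.differentiableAt.comp κ h1).const_add lam₀
        exact h2.differentiableWithinAt
    refine TendstoLocallyUniformlyOn.differentiableOn (φ := atTop) (F := p) ?_
      (Eventually.of_forall hpd) hU
    refine TendstoUniformlyOn.tendstoLocallyUniformlyOn ?_
    rw [Metric.tendstoUniformlyOn_iff]
    intro ε hε
    have h0 : Tendsto (fun n : ℕ => r / 2 * (1 / 2 : ℝ) ^ n / (1 - 1 / 2)) atTop (𝓝 0) := by
      have := ((tendsto_pow_atTop_nhds_zero_of_lt_one (r := (1 / 2 : ℝ)) (by norm_num)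
        (by norm_num)).const_mul (r / 2)).div_const (1 - 1 / 2)
      simpa using this
    filter_upwards [h0.eventually_lt_const hε] with n hn κ hκ
    rw [dist_comm]
    exact (dist_le_of_le_geometric_of_tendsto _ _ (by norm_num) (hdist κ hκ) (hlam κ hκ) n).trans_lt
      hn
  · have h1 : Tendsto (fun n => f κ (p n κ)) atTop (𝓝 (f κ (lam κ))) := by
      have h2 : ContinuousAt (f κ) (lam κ) := by
        have := (analyticAt_reducedSource (C := C κ) (z₀ := z₀) hA (hhalf (hmem κ hκ))
          ((hsmall κ hκ).isUnit _ (hhalf (hmem κ hκ)))).continuousAt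
        exact continuousAt_const.add (φ.continuous.continuousAt.comp this)
      exact h2.tendsto.comp (hlam κ hκ)
    have h3 : Tendsto (fun n => f κ (p n κ)) atTop (𝓝 (lam κ)) := by
      simp only [← hps]
      exact (tendsto_add_atTop_iff_nat 1).2 (hlam κ hκ)
    have h4 := tendsto_nhds_unique h1 h3
    rw [charFun, sub_sub]
    exact sub_eq_zero.2 h4.symm

end Dependence

/-! ### Orbits of immediately differentiable semigroups -/

section Orbits

variable {X : Type*} [NormedAddCommGroup X] [NormedSpace ℂ X] {T : ℝ → X →L[ℂ] X}
  {A : X →ₗ.[ℂ] X}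

theorem IsC0Semigroup.apply_add (hT : IsC0Semigroup T) {s t : ℝ} (hs : 0 ≤ s) (ht : 0 ≤ t) (x : X) :
    T (s + t) x = T s (T t x) := by
  rw [hT.map_add s t hs ht]; rfl

theorem continuousOn_orbit (hT : IsC0Semigroup T) (hTd : IsImmediatelyDifferentiable T) (x : X) :
    ContinuousOn (fun t => T t x) (Ici 0) := by
  intro t ht
  rcases (mem_Ici.1 ht).eq_or_lt with rfl | ht0
  · rw [← Ioi_insert, continuousWithinAt_insert_self, ContinuousWithinAt, hT.map_zero]
    exact hT.tendsto_zero x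
  · exact ((hTd x).differentiableAt (Ioi_mem_nhds ht0)).continuousAt.continuousWithinAt

/-- By the semigroup law, the difference quotient of the orbit at t is the generator's quotient at T
t x; differentiability therefore puts T t x in dom(A) for all x. -/
theorem orbit_mem_graph (hT : IsC0Semigroup T) (hTd : IsImmediatelyDifferentiable T)
    (hA : IsGenerator T A) (x : X) {t : ℝ} (ht : 0 < t) :
    (T t x, deriv (fun s => T s x) t) ∈ A.graph := by
  rw [hA]
  have hd := ((hTd x).differentiableAt (Ioi_mem_nhds ht)).hasDerivAt
  rw [hasDerivAt_iff_tendsto_slope_zero] at hd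
  refine (hd.mono_left (nhdsWithin_mono _ fun h hh => (mem_Ioi.1 hh).ne')).congr' ?_
  filter_upwards [self_mem_nhdsWithin] with h hh
  rw [add_comm t h, hT.apply_add (mem_Ioi.1 hh).le ht.le]

theorem apply_mem_graph (hT : IsC0Semigroup T) (hA : IsGenerator T A) {x a : X}
    (hx : (x, a) ∈ A.graph) {t : ℝ} (ht : 0 ≤ t) : (T t x, T t a) ∈ A.graph := by
  rw [hA] at hx ⊢
  refine (((T t).continuous.tendsto a).comp hx).congr' ?_
  filter_upwards [self_mem_nhdsWithin] with h hh
  have h1 : T t (T h x) = T h (T t x) := by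
    rw [← hT.apply_add ht (mem_Ioi.1 hh).le, ← hT.apply_add (mem_Ioi.1 hh).le ht, add_comm]
  simp only [Function.comp_apply, ← Complex.coe_smul, map_smul, map_sub, h1]

theorem deriv_orbit_of_mem_graph (hT : IsC0Semigroup T) (hTd : IsImmediatelyDifferentiable T)
    (hA : IsGenerator T A) {x a : X} (hx : (x, a) ∈ A.graph) {t : ℝ} (ht : 0 < t) :
    deriv (fun s => T s x) t = T t a :=
  LinearPMap.mem_graph_snd_inj A (orbit_mem_graph hT hTd hA x ht) (apply_mem_graph hT hA hx ht.le) rfl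

theorem deriv_orbit_add (hT : IsC0Semigroup T) (hTd : IsImmediatelyDifferentiable T)
    (hA : IsGenerator T A) (x : X) {s a : ℝ} (hs : 0 ≤ s) (ha : 0 < a) :
    deriv (fun s => T s x) (s + a) = T s (deriv (fun s => T s x) a) := by
  have h1 := apply_mem_graph hT hA (orbit_mem_graph hT hTd hA x ha) hs
  rw [← hT.apply_add hs ha.le] at h1
  exact LinearPMap.mem_graph_snd_inj A (orbit_mem_graph hT hTd hA x (by linarith)) h1 rfl

/-- Near t the derivative is T(s - t / 2) applied to the fixed vector A T(t / 2)x, hence continuous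
by strong continuity. -/
theorem continuousOn_deriv_orbit (hT : IsC0Semigroup T) (hTd : IsImmediatelyDifferentiable T)
    (hA : IsGenerator T A) (x : X) : ContinuousOn (deriv fun s => T s x) (Ioi 0) := by
  intro t ht
  have ht0 : (0 : ℝ) < t := ht
  refine ContinuousAt.continuousWithinAt ?_
  have h1 : ContinuousAt (fun s => T (s - t / 2) (deriv (fun s => T s x) (t / 2))) t := by
    refine ContinuousAt.comp (g := fun s => T s (deriv (fun s => T s x) (t / 2)))
      (f := fun s => s - t / 2) ?_ (by fun_prop)
    exact (continuousOn_orbit hT hTd _).continuousAt (Ici_mem_nhds (by linarith))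
  refine h1.congr ?_
  filter_upwards [Ioi_mem_nhds (show t / 2 < t by linarith)] with s hs
  have := deriv_orbit_add hT hTd hA x (s := s - t / 2) (a := t / 2) (by linarith [mem_Ioi.1 hs])
    (by linarith)
  rw [sub_add_cancel] at this
  exact this.symm

/-- `B T(t) x`, where `B = C (z₀ - A)` on `dom(A)` and `A` generates `T`. -/
noncomputable def pertOrbit (T : ℝ → X →L[ℂ] X) (z₀ : ℂ) (C : X →L[ℂ] X) (t : ℝ) (x : X) : X :=
  C (z₀ • T t x - deriv (fun s => T s x) t)

variable {z₀ : ℂ} {C : X →L[ℂ] X}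

theorem isLinearMap_pertOrbit (hTd : IsImmediatelyDifferentiable T) {t : ℝ} (ht : 0 < t) :
    IsLinearMap ℂ (pertOrbit T z₀ C t) := by
  have hd : ∀ x, DifferentiableAt ℝ (fun s => T s x) t := fun x =>
    (hTd x).differentiableAt (Ioi_mem_nhds ht)
  constructor
  · intro x y
    have h1 : deriv (fun s => T s (x + y)) t =
        deriv (fun s => T s x) t + deriv (fun s => T s y) t := by
      simp only [map_add]
      exact deriv_fun_add (hd x) (hd y)
    rw [pertOrbit, pertOrbit, pertOrbit, h1, ← map_add, map_add (T t), smul_add, add_sub_add_comm]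
  · intro c x
    have h1 : deriv (fun s => T s (c • x)) t = c • deriv (fun s => T s x) t := by
      simp only [map_smul]
      exact deriv_fun_const_smul c (hd x)
    rw [pertOrbit, pertOrbit, h1, map_smul (T t), smul_comm z₀ c, ← smul_sub, map_smul]

theorem pertOrbit_of_mem_graph (hT : IsC0Semigroup T) (hTd : IsImmediatelyDifferentiable T)
    (hA : IsGenerator T A) {x a : X} (hx : (x, a) ∈ A.graph) {t : ℝ} (ht : 0 < t) :
    pertOrbit T z₀ C t x = C (T t (z₀ • x - a)) := by
  rw [pertOrbit, deriv_orbit_of_mem_graph hT hTd hA hx ht, map_sub (T t), map_smul]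

theorem pertOrbit_add (hT : IsC0Semigroup T) (hTd : IsImmediatelyDifferentiable T)
    (hA : IsGenerator T A) (x : X) {s a : ℝ} (hs : 0 ≤ s) (ha : 0 < a) :
    pertOrbit T z₀ C (a + s) x = pertOrbit T z₀ C a (T s x) := by
  have h1 : T (a + s) x = T a (T s x) := hT.apply_add ha.le hs x
  have h2 : deriv (fun r => T r x) (a + s) = deriv (fun r => T r (T s x)) a := by
    have h3 := orbit_mem_graph hT hTd hA (T s x) ha
    rw [← h1] at h3
    exact LinearPMap.mem_graph_snd_inj A (orbit_mem_graph hT hTd hA x (by linarith)) h3 rfl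
  rw [pertOrbit, pertOrbit, h1, h2]

theorem continuousOn_pertOrbit (hT : IsC0Semigroup T) (hTd : IsImmediatelyDifferentiable T)
    (hA : IsGenerator T A) (x : X) : ContinuousOn (fun t => pertOrbit T z₀ C t x) (Ioi 0) :=
  C.continuous.comp_continuousOn (((continuousOn_orbit hT hTd x).mono Ioi_subset_Ici_self).const_smul
    z₀ |>.sub (continuousOn_deriv_orbit hT hTd hA x))

variable {B : X →ₗ.[ℂ] X}

/-- The Miyadera bound extends from `dom(A)` to the whole space. -/
theorem exists_miyadera_bound [CompleteSpace X] (hT : IsC0Semigroup T)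
    (hTd : IsImmediatelyDifferentiable T) (hA : IsGenerator T A)
    (hB : ∀ x a, (x, a) ∈ A.graph → val B x = C (z₀ • x - a)) (hS2 : CondS2 T A B) :
    ∃ q ∈ Ioo (0 : ℝ) 1, ∃ t₀ > 0, ∀ x,
      MeasureTheory.IntegrableOn (fun s => pertOrbit T z₀ C s x) (Ioc 0 t₀) ∧
      ∫ s in Ioc 0 t₀, ‖pertOrbit T z₀ C s x‖ ≤ q * ‖x‖ := by
  obtain ⟨q, hq, t₀, ht₀, h⟩ := hS2
  refine ⟨q, hq, t₀, ht₀, fun x => ?_⟩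
  have hc := continuousOn_pertOrbit (z₀ := z₀) (C := C) hT hTd hA x
  -- (S2) is applied to T(ε)x, which lies in dom(A); after the shift by ε, the piece over [t₀, t₀ +
  -- ε] is dropped.
  have hbound : ∀ ε ∈ Ioo 0 t₀, ∫ s in ε..t₀, ‖pertOrbit T z₀ C s x‖ ≤ q * ‖T ε x‖ := by
    intro ε hε
    have h1 := h (T ε x) (LinearPMap.mem_domain_of_mem_graph (orbit_mem_graph hT hTd hA x hε.1))
    have h2 : ∫ s in (0 : ℝ)..t₀, ‖val B (T s (T ε x))‖ =
        ∫ s in (0 : ℝ)..t₀, ‖pertOrbit T z₀ C (s + ε) x‖ := by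
      refine intervalIntegral.integral_congr fun s hs => ?_
      rw [uIcc_of_le ht₀.le] at hs
      have h3 := orbit_mem_graph hT hTd hA x (show 0 < s + ε by linarith [hs.1, hε.1])
      rw [← hT.apply_add hs.1 hε.1.le, hB _ _ h3, pertOrbit]
    have hint : ∀ a b : ℝ, 0 < a → 0 < b → IntervalIntegrable
        (fun s => ‖pertOrbit T z₀ C s x‖) MeasureTheory.volume a b := by
      intro a b ha hb
      refine (hc.norm.mono fun s hs => ?_).intervalIntegrable
      exact lt_of_lt_of_le (lt_min ha hb) hs.1
    rw [h2, intervalIntegral.integral_comp_add_right (fun s => ‖pertOrbit T z₀ C s x‖), zero_add,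
      ← intervalIntegral.integral_add_adjacent_intervals (hint ε t₀ hε.1 ht₀)
        (hint t₀ (t₀ + ε) ht₀ (by linarith [hε.1]))] at h1
    have h4 : 0 ≤ ∫ s in t₀..t₀ + ε, ‖pertOrbit T z₀ C s x‖ :=
      intervalIntegral.integral_nonneg (by linarith [hε.1]) fun _ _ => norm_nonneg _
    linarith
  have hnorm : Tendsto (fun ε => q * ‖T ε x‖) (𝓝[>] 0) (𝓝 (q * ‖x‖)) :=
    ((hT.tendsto_zero x).norm).const_mul q
  have hint : MeasureTheory.IntegrableOn (fun s => pertOrbit T z₀ C s x) (Ioc 0 t₀) := by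
    -- Integrability up to 0 is not given for x outside dom(A); it follows from the bounded
    -- integrals over (ε n, t₀]. The shift by 2 keeps ε n strictly below t₀.
    set ε : ℕ → ℝ := fun n => t₀ / (n + 2) with hε
    have hε0 : ∀ n, ε n ∈ Ioo 0 t₀ := fun n =>
      ⟨by positivity, div_lt_self ht₀ (by linarith [(Nat.cast_nonneg n : (0 : ℝ) ≤ n)])⟩
    have hεlim : Tendsto ε atTop (𝓝 0) :=
      tendsto_const_nhds.div_atTop (tendsto_atTop_add_const_right _ _ tendsto_natCast_atTop_atTop)
    have hεlim' : Tendsto ε atTop (𝓝[>] 0) :=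
      tendsto_nhdsWithin_iff.2 ⟨hεlim, Eventually.of_forall fun n => (hε0 n).1⟩
    refine MeasureTheory.integrableOn_Ioc_of_intervalIntegral_norm_bounded_left
      (I := q * ‖x‖ + 1) (a := ε) (l := atTop) (fun n => ?_) hεlim ?_
    · refine (ContinuousOn.integrableOn_Icc (hc.mono fun s hs => ?_)).mono_set Ioc_subset_Icc_self
      exact lt_of_lt_of_le (hε0 n).1 hs.1
    · filter_upwards [(hnorm.comp hεlim').eventually_lt_const (lt_add_one _)] with n hn
      rw [← intervalIntegral.integral_of_le (hε0 n).2.le]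
      exact (hbound _ (hε0 n)).trans hn.le
  refine ⟨hint, ?_⟩
  rw [← intervalIntegral.integral_of_le ht₀.le]
  have hlim : Tendsto (fun ε => ∫ s in ε..t₀, ‖pertOrbit T z₀ C s x‖) (𝓝[>] 0)
      (𝓝 (∫ s in (0 : ℝ)..t₀, ‖pertOrbit T z₀ C s x‖)) := by
    have h1 := intervalIntegral.continuousOn_primitive_interval_left
      (f := fun s => ‖pertOrbit T z₀ C s x‖) (a := 0) (b := t₀) (μ := MeasureTheory.volume)
      (by rw [uIcc_of_le ht₀.le, integrableOn_Icc_iff_integrableOn_Ioc]; exact hint.norm)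
    refine (h1 0 left_mem_uIcc).mono_left ?_
    rw [uIcc_of_le ht₀.le, ← nhdsWithin_Ioc_eq_nhdsGT ht₀]
    exact nhdsWithin_mono _ Ioc_subset_Icc_self
  refine le_of_tendsto_of_tendsto hlim hnorm ?_
  filter_upwards [Ioo_mem_nhdsGT ht₀] with ε hε using hbound ε hε

/-! #### Variation of constants for an eigenvector -/

variable {lam : ℂ} {u w : X}

theorem hasDerivAt_exp_smul (lam : ℂ) {f : ℝ → X} {f' : X} {s : ℝ} (hf : HasDerivAt f f' s) :
    HasDerivAt (fun s : ℝ => Complex.exp (-lam * s) • f s)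
      (Complex.exp (-lam * s) • (f' - lam • f s)) s := by
  have h1 : HasDerivAt (fun s : ℝ => Complex.exp (-lam * s)) (Complex.exp (-lam * s) * (-lam)) s := by
    have h2 : HasDerivAt (fun s : ℝ => -lam * (s : ℂ)) (-lam) s := by
      simpa using (Complex.ofRealCLM.hasDerivAt (x := s)).const_mul (-lam)
    exact h2.cexp
  refine (h1.smul hf).congr_deriv ?_
  rw [smul_sub, mul_neg, neg_smul, mul_smul]
  abel

/-- If `(A + B) u = lam u` and `w = B u`, then `u` is recovered from `w` through the semigroup. -/
theorem eigenvector_eq [CompleteSpace X] (hT : IsC0Semigroup T)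
    (hTd : IsImmediatelyDifferentiable T) (hA : IsGenerator T A)
    (hu : (u, lam • u - w) ∈ A.graph) {t : ℝ} (ht : 0 ≤ t) :
    u = Complex.exp (-lam * t) • T t u + ∫ s in (0 : ℝ)..t, Complex.exp (-lam * s) • T s w := by
  have hcw : ContinuousOn (fun s : ℝ => Complex.exp (-lam * s) • T s w) (Icc 0 t) :=
    ContinuousOn.fun_smul (by fun_prop) ((continuousOn_orbit hT hTd w).mono Icc_subset_Ici_self)
  have hcu : ContinuousOn (fun s : ℝ => Complex.exp (-lam * s) • T s u) (Icc 0 t) :=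
    ContinuousOn.fun_smul (by fun_prop) ((continuousOn_orbit hT hTd u).mono Icc_subset_Ici_self)
  -- Since (A - lam)u = -w, integrating this derivative over [0, t] gives the claim.
  have hder : ∀ s ∈ Ioo 0 t, HasDerivAt (fun s : ℝ => Complex.exp (-lam * s) • T s u)
      (-(Complex.exp (-lam * s) • T s w)) s := by
    intro s hs
    have h1 := ((hTd u).differentiableAt (Ioi_mem_nhds hs.1)).hasDerivAt
    rw [deriv_orbit_of_mem_graph hT hTd hA hu hs.1] at h1
    refine (hasDerivAt_exp_smul lam h1).congr_deriv ?_
    rw [map_sub, map_smul, sub_sub_cancel_left, smul_neg]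
  have h := intervalIntegral.integral_eq_sub_of_hasDerivAt_of_le ht hcu hder
    (hcw.neg.intervalIntegrable_of_Icc ht)
  rw [intervalIntegral.integral_neg, hT.map_zero] at h
  simp only [Complex.ofReal_zero, mul_zero, Complex.exp_zero, one_smul, one_apply_eq_self] at h
  rw [neg_eq_iff_eq_neg] at h
  rw [h]
  abel

/-- If `(A + B) u = lam u`, then `w = B u` solves a Volterra type equation. -/
theorem source_eq [CompleteSpace X] (hT : IsC0Semigroup T)
    (hTd : IsImmediatelyDifferentiable T) (hA : IsGenerator T A)
    (hu : (u, lam • u - w) ∈ A.graph) (hw : w = C (z₀ • u - (lam • u - w))) {t : ℝ} (ht : 0 < t)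
    (hint : MeasureTheory.IntegrableOn (fun s => pertOrbit T z₀ C s w) (Ioc 0 t)) :
    w = Complex.exp (-lam * t) • pertOrbit T z₀ C t u +
      ∫ s in (0 : ℝ)..t, Complex.exp (-lam * s) • pertOrbit T z₀ C s w := by
  set a := lam • u - w with ha
  set y := z₀ • u - a with hy
  have hexp : Continuous fun s : ℝ => Complex.exp (-lam * s) := by fun_prop
  have hcy : ContinuousOn (fun s : ℝ => Complex.exp (-lam * s) • C (T s y)) (Icc 0 t) :=
    ContinuousOn.fun_smul hexp.continuousOn
      (C.continuous.comp_continuousOn ((continuousOn_orbit hT hTd y).mono Icc_subset_Ici_self))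
  -- Formally (A - lam)T(s)y = -(z₀ - A)T(s)w, because y = (z₀ - A)u and (A - lam)u = -w. As y need
  -- not lie in dom(A), the identity is obtained by differentiating orbits. At s = 0 one has C y =
  -- w.
  have hlin : ∀ s, 0 < s → deriv (fun s => T s y) s - lam • T s y =
      -(z₀ • T s w - deriv (fun s => T s w) s) := by
    intro s hs
    have hd : ∀ x, DifferentiableAt ℝ (fun s => T s x) s := fun x =>
      (hTd x).differentiableAt (Ioi_mem_nhds hs)
    have h1 : deriv (fun s => T s y) s = z₀ • deriv (fun s => T s u) s - deriv (fun s => T s a) s := by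
      simp only [hy, map_sub, map_smul]
      rw [deriv_fun_sub ((hd u).fun_const_smul z₀) (hd a), deriv_fun_const_smul z₀ (hd u)]
    have h2 : deriv (fun s => T s a) s = lam • deriv (fun s => T s u) s - deriv (fun s => T s w) s := by
      simp only [ha, map_sub, map_smul]
      rw [deriv_fun_sub ((hd u).fun_const_smul lam) (hd w), deriv_fun_const_smul lam (hd u)]
    have h3 : deriv (fun s => T s u) s = lam • T s u - T s w := by
      rw [deriv_orbit_of_mem_graph hT hTd hA hu hs, ha, map_sub, map_smul]
    rw [h1, h2, h3, hy, ha]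
    simp only [map_sub, map_smul, smul_sub]
    rw [smul_comm z₀ lam]
    abel
  have hder : ∀ s ∈ Ioo 0 t, HasDerivAt (fun s : ℝ => Complex.exp (-lam * s) • C (T s y))
      (-(Complex.exp (-lam * s) • pertOrbit T z₀ C s w)) s := by
    intro s hs
    have h1 := ((hTd y).differentiableAt (Ioi_mem_nhds hs.1)).hasDerivAt
    have h2 : HasDerivAt (fun s => C (T s y)) (C (deriv (fun s => T s y) s)) s :=
      (C.restrictScalars ℝ).hasFDerivAt.comp_hasDerivAt s h1
    refine (hasDerivAt_exp_smul lam h2).congr_deriv ?_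
    rw [← map_smul, ← map_sub, hlin s hs.1, map_neg, smul_neg, pertOrbit]
  have hint' : IntervalIntegrable (fun s : ℝ => -(Complex.exp (-lam * s) • pertOrbit T z₀ C s w))
      MeasureTheory.volume 0 t := by
    refine IntervalIntegrable.neg ?_
    have h1 : IntervalIntegrable (fun s => pertOrbit T z₀ C s w) MeasureTheory.volume 0 t :=
      (intervalIntegrable_iff_integrableOn_Ioc_of_le ht.le).2 hint
    exact h1.continuousOn_smul hexp.continuousOn
  have h := intervalIntegral.integral_eq_sub_of_hasDerivAt_of_le ht.le hcy hder hint'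
  rw [intervalIntegral.integral_neg, hT.map_zero] at h
  simp only [Complex.ofReal_zero, mul_zero, Complex.exp_zero, one_smul, one_apply_eq_self] at h
  rw [neg_eq_iff_eq_neg, ← hw] at h
  rw [h, pertOrbit_of_mem_graph hT hTd hA hu ht]
  abel

end Orbits

/-! ### Eigenvectors in the embedded space -/

section Embedded

variable {X V : Type*} [NormedAddCommGroup X] [NormedSpace ℂ X]
  [NormedAddCommGroup V] [NormedSpace ℂ V]
  {ι : V →L[ℂ] X} {T : ℝ → X →L[ℂ] X} {A B : X →ₗ.[ℂ] X} {z₀ : ℂ} {C : X →L[ℂ] X}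

/-- Injectivity of ι makes the chosen preimages unique, hence linear in x. -/
theorem exists_lift {E : Type*} [NormedAddCommGroup E] [NormedSpace ℂ E]
    (hι : Function.Injective ι) {f : E → X} (hf : IsLinearMap ℂ f) {K : ℝ} (hK : 0 ≤ K)
    (h : ∀ x, ∃ v, ι v = f x ∧ ‖v‖ ≤ K * ‖x‖) :
    ∃ g : E →L[ℂ] V, ‖g‖ ≤ K ∧ ∀ x, ι (g x) = f x := by
  choose g hg hgK using h
  let g' : E →ₗ[ℂ] V :=
    { toFun := g
      map_add' := fun x y => hι (by rw [map_add, hg, hg, hg, hf.map_add])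
      map_smul' := fun c x => hι (by rw [RingHom.id_apply, map_smul, hg, hg, hf.map_smul]) }
  exact ⟨g'.mkContinuous K hgK, g'.mkContinuous_norm_le hK hgK, hg⟩

theorem exists_smoothing (hι : Function.Injective ι) (hS1 : CondS1 ι T) :
    ∃ (S : ℝ → X →L[ℂ] V) (K α : ℝ), 0 ≤ K ∧ 0 < α ∧ ∀ s ∈ Ioc (0 : ℝ) 1,
      ‖S s‖ ≤ K * s ^ (-α) ∧ ∀ x, ι (S s x) = T s x := by
  obtain ⟨K, α, hK, hα, h⟩ := hS1
  have h1 : ∀ s : ℝ, ∃ g : X →L[ℂ] V, s ∈ Ioc (0 : ℝ) 1 →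
      ‖g‖ ≤ K * s ^ (-α) ∧ ∀ x, ι (g x) = T s x := by
    intro s
    by_cases hs : s ∈ Ioc (0 : ℝ) 1
    · have hs0 := hs.1
      obtain ⟨g, hg⟩ := exists_lift hι (T s).toLinearMap.isLinear
        (show 0 ≤ K * s ^ (-α) by positivity) (h s hs)
      exact ⟨g, fun _ => hg⟩
    · exact ⟨0, fun h => absurd h hs⟩
  choose S hS using h1
  exact ⟨S, K, α, by linarith, hα, hS⟩

theorem exists_lift_pertOrbit (hι : Function.Injective ι) (hT : IsC0Semigroup T)
    (hTd : IsImmediatelyDifferentiable T) (hA : IsGenerator T A) (hdom : B.domain = A.domain)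
    (hB : ∀ x a, (x, a) ∈ A.graph → val B x = C (z₀ • x - a)) (hS3 : CondS3 ι T B) :
    ∃ (S : ℝ → V →L[ℂ] V) (K β : ℝ), 0 ≤ K ∧ β ∈ Ico (0 : ℝ) 1 ∧ ∀ s ∈ Ioc (0 : ℝ) 1,
      ‖S s‖ ≤ K * s ^ (-β) ∧ ∀ v, ι (S s v) = pertOrbit T z₀ C s (ι v) := by
  obtain ⟨K, β, hK, hβ, h⟩ := hS3
  have h1 : ∀ s : ℝ, ∃ g : V →L[ℂ] V, s ∈ Ioc (0 : ℝ) 1 →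
      ‖g‖ ≤ K * s ^ (-β) ∧ ∀ v, ι (g v) = pertOrbit T z₀ C s (ι v) := by
    intro s
    by_cases hs : s ∈ Ioc (0 : ℝ) 1
    · have hs0 := hs.1
      have hlin : IsLinearMap ℂ fun v => pertOrbit T z₀ C s (ι v) :=
        ((isLinearMap_pertOrbit hTd hs.1).mk' _ ∘ₗ ι.toLinearMap).isLinear
      obtain ⟨g, hg⟩ := exists_lift hι hlin (show 0 ≤ K * s ^ (-β) by positivity) fun v => by
        have h2 := orbit_mem_graph hT hTd hA (ι v) hs.1
        have h3 : T s (ι v) ∈ B.domain := hdom ▸ LinearPMap.mem_domain_of_mem_graph h2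
        obtain ⟨w, hw, hwK⟩ := (h s hs v).2 h3
        refine ⟨w, ?_, hwK⟩
        rw [hw, pertOrbit, ← hB _ _ h2, val, dif_pos h3]
      exact ⟨g, fun _ => hg⟩
    · exact ⟨0, fun h => absurd h hs⟩
  choose S hS using h1
  exact ⟨S, K, β, by linarith, hβ, hS⟩

variable {S : ℝ → X →L[ℂ] V}

/-- Near t one has S(s)x = S(t / 2)T(s - t / 2)x: a fixed bounded operator into V after an orbit
continuous in X. -/
theorem continuousOn_smoothing (hι : Function.Injective ι) (hT : IsC0Semigroup T)
    (hTd : IsImmediatelyDifferentiable T) (hS : ∀ s ∈ Ioc (0 : ℝ) 1, ∀ x, ι (S s x) = T s x)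
    (x : X) : ContinuousOn (fun s => S s x) (Ioc 0 1) := by
  intro t ht
  have ht0 := ht.1
  have h1 : ContinuousAt (fun s => S (t / 2) (T (s - t / 2) x)) t := by
    refine (S (t / 2)).continuous.continuousAt.comp ?_
    refine ContinuousAt.comp (g := fun s => T s x) (f := fun s => s - t / 2) ?_ (by fun_prop)
    exact (continuousOn_orbit hT hTd x).continuousAt (Ici_mem_nhds (by linarith))
  have h2 : ∀ s ∈ Ioc (t / 2) 1, S s x = S (t / 2) (T (s - t / 2) x) := by
    intro s hs
    apply hι
    rw [hS s ⟨by linarith [hs.1], hs.2⟩, hS (t / 2) ⟨by linarith, by linarith [ht.2]⟩,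
      ← hT.apply_add (by linarith) (by linarith [hs.1]), add_sub_cancel]
  refine h1.continuousWithinAt.congr_of_eventuallyEq ?_ (h2 t ⟨by linarith, ht.2⟩)
  filter_upwards [self_mem_nhdsWithin,
    mem_nhdsWithin_of_mem_nhds (Ioi_mem_nhds (show t / 2 < t by linarith))] with s hs hs'
  exact h2 s ⟨hs', hs.2⟩

theorem continuousOn_lift_pertOrbit (hι : Function.Injective ι) (hT : IsC0Semigroup T)
    (hTd : IsImmediatelyDifferentiable T) (hA : IsGenerator T A)
    (hS : ∀ s ∈ Ioc (0 : ℝ) 1, ∀ x, ι (S s x) = T s x) {L : ℝ → V →L[ℂ] V}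
    (hL : ∀ s ∈ Ioc (0 : ℝ) 1, ∀ v, ι (L s v) = pertOrbit T z₀ C s (ι v)) (v : V) :
    ContinuousOn (fun s => L s v) (Ioc 0 1) := by
  intro t ht
  have ht0 := ht.1
  have h1 : ContinuousWithinAt (fun s => L (t / 2) (S (s - t / 2) (ι v))) (Ioc (t / 2) 1) t := by
    refine (L (t / 2)).continuous.continuousAt.comp_continuousWithinAt ?_
    refine ContinuousWithinAt.comp (g := fun s => S s (ι v)) (f := fun s => s - t / 2) (t := Ioc 0 1)
      (continuousOn_smoothing hι hT hTd hS (ι v) _ ⟨by linarith, by linarith [ht.2]⟩)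
      (by fun_prop) fun s hs => ⟨by linarith [hs.1], by linarith [hs.2]⟩
  have h2 : ∀ s ∈ Ioc (t / 2) 1, L s v = L (t / 2) (S (s - t / 2) (ι v)) := by
    intro s hs
    apply hι
    rw [hL s ⟨by linarith [hs.1], hs.2⟩, hL (t / 2) ⟨by linarith, by linarith [ht.2]⟩,
      hS (s - t / 2) ⟨by linarith [hs.1], by linarith [hs.2]⟩,
      ← pertOrbit_add hT hTd hA _ (by linarith [hs.1]) (by linarith), add_sub_cancel]
  have h3 := h1.congr h2 (h2 t ⟨by linarith, ht.2⟩)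
  refine h3.mono_of_mem_nhdsWithin ?_
  filter_upwards [self_mem_nhdsWithin,
    mem_nhdsWithin_of_mem_nhds (Ioi_mem_nhds (show t / 2 < t by linarith))] with s hs hs'
  exact ⟨hs', hs.2⟩

variable {lam : ℂ} {u w : X}

theorem norm_exp_neg_mul_le (lam : ℂ) {s t : ℝ} (hs : 0 ≤ s) (hst : s ≤ t) :
    ‖Complex.exp (-lam * s)‖ ≤ Real.exp (‖lam‖ * t) := by
  refine (Complex.norm_exp_le_exp_norm _).trans (Real.exp_le_exp.2 ?_)
  rw [norm_mul, norm_neg, Complex.norm_real, Real.norm_of_nonneg hs]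
  gcongr

/-- Uniqueness for the Volterra type equation satisfied by `B u`. -/
theorem eq_zero_of_eq_integral_pertOrbit {q t₀ t : ℝ} (ht : 0 ≤ t) (htt : t ≤ t₀) {d : X}
    (hint : MeasureTheory.IntegrableOn (fun s => pertOrbit T z₀ C s d) (Ioc 0 t₀))
    (hq : ∫ s in Ioc 0 t₀, ‖pertOrbit T z₀ C s d‖ ≤ q * ‖d‖)
    (hqt : Real.exp (‖lam‖ * t) * q < 1)
    (hd : d = ∫ s in (0 : ℝ)..t, Complex.exp (-lam * s) • pertOrbit T z₀ C s d) : d = 0 := by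
  have h1 : ‖d‖ ≤ Real.exp (‖lam‖ * t) * q * ‖d‖ := by
    calc ‖d‖ = ‖∫ s in (0 : ℝ)..t, Complex.exp (-lam * s) • pertOrbit T z₀ C s d‖ := by rw [← hd]
      _ ≤ ∫ s in (0 : ℝ)..t, Real.exp (‖lam‖ * t) * ‖pertOrbit T z₀ C s d‖ := by
        refine intervalIntegral.norm_integral_le_of_norm_le ht ?_ ?_
        · refine Eventually.of_forall fun s hs => ?_
          rw [norm_smul]
          gcongr
          exact norm_exp_neg_mul_le lam hs.1.le hs.2
        · refine IntervalIntegrable.const_mul ?_ _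
          rw [intervalIntegrable_iff_integrableOn_Ioc_of_le ht]
          exact (hint.mono_set (Ioc_subset_Ioc_right htt)).norm
      _ = Real.exp (‖lam‖ * t) * ∫ s in Ioc 0 t, ‖pertOrbit T z₀ C s d‖ := by
        rw [intervalIntegral.integral_const_mul, intervalIntegral.integral_of_le ht]
      _ ≤ Real.exp (‖lam‖ * t) * ∫ s in Ioc 0 t₀, ‖pertOrbit T z₀ C s d‖ := by
        refine mul_le_mul_of_nonneg_left ?_ (Real.exp_pos _).le
        exact MeasureTheory.setIntegral_mono_set hint.norm
          (Eventually.of_forall fun _ => norm_nonneg _) (Ioc_subset_Ioc_right htt).eventuallyLE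
      _ ≤ Real.exp (‖lam‖ * t) * (q * ‖d‖) := by gcongr
      _ = _ := by ring
  by_contra hne
  have h2 : 0 < ‖d‖ := norm_pos_iff.2 hne
  nlinarith

/-- If `(A + B) u = lam u`, then `w = B u` belongs to `V`. -/
theorem source_mem_range [CompleteSpace X] [CompleteSpace V] (hι : Function.Injective ι)
    (hT : IsC0Semigroup T) (hTd : IsImmediatelyDifferentiable T) (hA : IsGenerator T A)
    (hdom : B.domain = A.domain) (hB : ∀ x a, (x, a) ∈ A.graph → val B x = C (z₀ • x - a))
    (hS2 : CondS2 T A B) (hS3 : CondS3 ι T B)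
    (hS : ∀ s ∈ Ioc (0 : ℝ) 1, ∀ x, ι (S s x) = T s x)
    (hu : (u, lam • u - w) ∈ A.graph) (hw : w = C (z₀ • u - (lam • u - w))) : w ∈ range ι := by
  obtain ⟨q, hq, t₀, ht₀, hM⟩ := exists_miyadera_bound hT hTd hA hB hS2
  obtain ⟨L, K, β, hK, hβ, hL⟩ := exists_lift_pertOrbit hι hT hTd hA hdom hB hS3
  have hLc := continuousOn_lift_pertOrbit hι hT hTd hA hS fun s hs => (hL s hs).2
  have hβ1 : 0 < 1 - β := by linarith [hβ.2]
  -- A single short time serves twice: the Volterra operator must contract in X, by (S2), and in V,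
  -- where ∫₀ᵗ K s ^ (-β) ds = K t ^ (1 - β) / (1 - β).
  obtain ⟨t, ht, ht1, htt, hqt, hkt⟩ : ∃ t : ℝ, 0 < t ∧ t ≤ 1 ∧ t ≤ t₀ ∧
      Real.exp (‖lam‖ * t) * q < 1 ∧
      Real.exp (‖lam‖ * t) * K * (t ^ (1 - β) / (1 - β)) < 1 := by
    have h1 : Tendsto (fun t : ℝ => Real.exp (‖lam‖ * t) * q) (𝓝[>] 0) (𝓝 q) := by
      have : ContinuousAt (fun t : ℝ => Real.exp (‖lam‖ * t) * q) 0 := by fun_prop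
      simpa using this.tendsto.mono_left nhdsWithin_le_nhds
    have h2 : Tendsto (fun t : ℝ => Real.exp (‖lam‖ * t) * K * (t ^ (1 - β) / (1 - β)))
        (𝓝[>] 0) (𝓝 0) := by
      have h3 : ContinuousAt (fun t : ℝ => t ^ (1 - β)) 0 :=
        Real.continuousAt_rpow_const _ _ (Or.inr hβ1.le)
      have : ContinuousAt
          (fun t : ℝ => Real.exp (‖lam‖ * t) * K * (t ^ (1 - β) / (1 - β))) 0 := by fun_prop
      simpa [Real.zero_rpow hβ1.ne'] using this.tendsto.mono_left nhdsWithin_le_nhds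
    obtain ⟨t, h⟩ := ((h1.eventually_lt_const hq.2).and ((h2.eventually_lt_const one_pos).and
      (Ioo_mem_nhdsGT (show (0 : ℝ) < min 1 t₀ from lt_min one_pos ht₀)))).exists
    exact ⟨t, h.2.2.1, h.2.2.2.le.trans (min_le_left _ _), h.2.2.2.le.trans (min_le_right _ _),
      h.1, h.2.1⟩
  have hrpow : IntervalIntegrable (fun s : ℝ => s ^ (-β)) MeasureTheory.volume 0 t :=
    intervalIntegral.intervalIntegrable_rpow' (by linarith [hβ.2])
  have hmem : ∀ s ∈ Ioc 0 t, s ∈ Ioc (0 : ℝ) 1 := fun s hs => ⟨hs.1, hs.2.trans ht1⟩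
  have hnorm : ∀ v, ∀ s ∈ Ioc 0 t, ‖Complex.exp (-lam * s) • L s v‖ ≤
      Real.exp (‖lam‖ * t) * K * ‖v‖ * s ^ (-β) := by
    intro v s hs
    calc ‖Complex.exp (-lam * s) • L s v‖ = ‖Complex.exp (-lam * s)‖ * ‖L s v‖ := norm_smul _ _
      _ ≤ Real.exp (‖lam‖ * t) * (K * s ^ (-β) * ‖v‖) := by
        gcongr
        · exact norm_exp_neg_mul_le lam hs.1.le hs.2
        · exact (L s).le_of_opNorm_le (hL s (hmem s hs)).1 v
      _ = _ := by ring
  have hint : ∀ v, IntervalIntegrable (fun s : ℝ => Complex.exp (-lam * s) • L s v)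
      MeasureTheory.volume 0 t := by
    intro v
    refine (hrpow.const_mul (Real.exp (‖lam‖ * t) * K * ‖v‖)).mono_fun' ?_ ?_
    · rw [uIoc_of_le ht.le]
      refine ContinuousOn.aestronglyMeasurable ?_ measurableSet_Ioc
      exact ContinuousOn.fun_smul (by fun_prop) ((hLc v).mono hmem)
    · rw [uIoc_of_le ht.le]
      exact (MeasureTheory.ae_restrict_iff' measurableSet_Ioc).2
        (Eventually.of_forall fun s hs => hnorm v s hs)
  -- BT(t)u = BT(t / 2)T(t / 2)u: the inner half maps into V, and the outer half preserves V.
  obtain ⟨g, hg⟩ : ∃ g, ι g = Complex.exp (-lam * t) • pertOrbit T z₀ C t u := by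
    refine ⟨Complex.exp (-lam * t) • L (t / 2) (S (t / 2) u), ?_⟩
    have h2 : t / 2 ∈ Ioc (0 : ℝ) 1 := ⟨by linarith, by linarith⟩
    rw [map_smul, (hL _ h2).2, hS _ h2, ← pertOrbit_add hT hTd hA _ h2.1.le h2.1, add_halves]
  set f : V → V := fun v => g + ∫ s in (0 : ℝ)..t, Complex.exp (-lam * s) • L s v with hf
  set k : ℝ := Real.exp (‖lam‖ * t) * K * (t ^ (1 - β) / (1 - β)) with hk
  have hk0 : 0 ≤ k := by positivity
  have hcontr : ContractingWith ⟨k, hk0⟩ f := by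
    refine ⟨by exact_mod_cast hkt, LipschitzWith.of_dist_le_mul fun v v' => ?_⟩
    rw [dist_eq_norm, dist_eq_norm, hf]
    simp only [add_sub_add_left_eq_sub]
    rw [← intervalIntegral.integral_sub (hint v) (hint v')]
    simp only [← smul_sub, ← map_sub]
    calc ‖∫ s in (0 : ℝ)..t, Complex.exp (-lam * s) • L s (v - v')‖
        ≤ ∫ s in (0 : ℝ)..t, Real.exp (‖lam‖ * t) * K * ‖v - v'‖ * s ^ (-β) :=
          intervalIntegral.norm_integral_le_of_norm_le ht.le
            (Eventually.of_forall fun s hs => hnorm _ s hs) (hrpow.const_mul _)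
      _ = k * ‖v - v'‖ := by
        rw [intervalIntegral.integral_const_mul, integral_rpow (Or.inl (by linarith [hβ.2])),
          show -β + 1 = 1 - β by ring, Real.zero_rpow hβ1.ne', hk]
        ring
  set v := hcontr.fixedPoint f with hv
  have hfix : f v = v := hcontr.fixedPoint_isFixedPt
  have h1 : ι v = Complex.exp (-lam * t) • pertOrbit T z₀ C t u +
      ∫ s in (0 : ℝ)..t, Complex.exp (-lam * s) • pertOrbit T z₀ C s (ι v) := by
    conv_lhs => rw [← hfix, hf]
    rw [map_add, hg, ← ι.intervalIntegral_comp_comm (hint v)]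
    congr 1
    refine intervalIntegral.integral_congr_ae (Eventually.of_forall fun s hs => ?_)
    rw [uIoc_of_le ht.le] at hs
    rw [map_smul, (hL s (hmem s hs)).2]
  have hI : ∀ x, IntervalIntegrable (fun s : ℝ => Complex.exp (-lam * s) • pertOrbit T z₀ C s x)
      MeasureTheory.volume 0 t := fun x => by
    have h3 : IntervalIntegrable (fun s => pertOrbit T z₀ C s x) MeasureTheory.volume 0 t :=
      (intervalIntegrable_iff_integrableOn_Ioc_of_le ht.le).2
        ((hM x).1.mono_set (Ioc_subset_Ioc_right htt))
    exact h3.continuousOn_smul (by fun_prop)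
  have h2 := source_eq hT hTd hA hu hw ht ((hM w).1.mono_set (Ioc_subset_Ioc_right htt))
  -- Both ι v, from the fixed point in V, and w solve the Volterra equation in X; their difference
  -- solves the homogeneous one and vanishes.
  refine ⟨v, (sub_eq_zero.1 ?_).symm⟩
  refine eq_zero_of_eq_integral_pertOrbit ht.le htt (hM _).1 (hM _).2 hqt ?_
  conv_lhs => rw [h1, h2]
  rw [add_sub_add_left_eq_sub, ← intervalIntegral.integral_sub (hI _) (hI _)]
  refine intervalIntegral.integral_congr_ae (Eventually.of_forall fun s hs => ?_)
  rw [uIoc_of_le ht.le] at hs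
  rw [← smul_sub, (isLinearMap_pertOrbit hTd hs.1).map_sub]

theorem exists_bound_smoothing (hι : Function.Injective ι) (hS3 : CondS3 ι T B)
    (hS : ∀ s ∈ Ioc (0 : ℝ) 1, ∀ x, ι (S s x) = T s x) (hw : w ∈ range ι) :
    ∃ m, ∀ s ∈ Ioc (0 : ℝ) 1, ‖S s w‖ ≤ m := by
  obtain ⟨K, β, hK, hβ, h⟩ := hS3
  obtain ⟨v, rfl⟩ := hw
  refine ⟨K * ‖v‖, fun s hs => ?_⟩
  obtain ⟨y, hy, hyK⟩ := (h s hs v).1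
  rwa [hι (show ι (S s (ι v)) = ι y by rw [hS s hs, hy])]

/-- The eigenvector `u` as an element of `V`, where `w = B u`. -/
noncomputable def smoothVector (S : ℝ → X →L[ℂ] V) (lam : ℂ) (u w : X) : V :=
  Complex.exp (-lam) • S 1 u + ∫ s in (0 : ℝ)..1, Complex.exp (-lam * s) • S s w

/-- Boundedness of S(s)w in V makes the integral converge in V, so ι passes inside, and variation of
constants at t = 1 gives u. -/
theorem map_smoothVector [CompleteSpace X] [CompleteSpace V] (hι : Function.Injective ι)
    (hT : IsC0Semigroup T) (hTd : IsImmediatelyDifferentiable T) (hA : IsGenerator T A)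
    (hS : ∀ s ∈ Ioc (0 : ℝ) 1, ∀ x, ι (S s x) = T s x) (hu : (u, lam • u - w) ∈ A.graph)
    (hw : ∃ m, ∀ s ∈ Ioc (0 : ℝ) 1, ‖S s w‖ ≤ m) : ι (smoothVector S lam u w) = u := by
  obtain ⟨m, hm⟩ := hw
  have hint : IntervalIntegrable (fun s : ℝ => Complex.exp (-lam * s) • S s w)
      MeasureTheory.volume 0 1 := by
    have h1 : IntervalIntegrable (fun s => S s w) MeasureTheory.volume 0 1 := by
      refine (intervalIntegrable_const (c := m)).mono_fun' ?_ ?_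
      · rw [uIoc_of_le zero_le_one]
        exact (continuousOn_smoothing hι hT hTd hS w).aestronglyMeasurable measurableSet_Ioc
      · rw [uIoc_of_le zero_le_one]
        exact (MeasureTheory.ae_restrict_iff' measurableSet_Ioc).2 (Eventually.of_forall hm)
    exact h1.continuousOn_smul (by fun_prop)
  rw [smoothVector, map_add, map_smul, hS 1 ⟨one_pos, le_rfl⟩, ← ι.intervalIntegral_comp_comm hint]
  conv_rhs => rw [eigenvector_eq hT hTd hA hu zero_le_one]
  rw [Complex.ofReal_one, mul_one]
  congr 1
  refine intervalIntegral.integral_congr_ae (Eventually.of_forall fun s hs => ?_)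
  rw [uIoc_of_le zero_le_one] at hs
  rw [map_smul, hS s hs]

/-- Holomorphic dependence of the eigenvector, as an element of `V`. Boundedness of the integrand
in `s` is assumed for each parameter separately. -/
theorem differentiableOn_smoothVector [CompleteSpace V] (hι : Function.Injective ι)
    (hT : IsC0Semigroup T) (hTd : IsImmediatelyDifferentiable T)
    {K α : ℝ} (hK : 0 ≤ K) (hα : 0 < α)
    (hS : ∀ s ∈ Ioc (0 : ℝ) 1, ‖S s‖ ≤ K * s ^ (-α) ∧ ∀ x, ι (S s x) = T s x)
    {U : Set ℂ} (hU : IsOpen U) {lam : ℂ → ℂ} {u w : ℂ → X} (hlam : DifferentiableOn ℂ lam U)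
    (hu : DifferentiableOn ℂ u U) (hw : DifferentiableOn ℂ w U)
    (hb : ∀ κ ∈ U, ∃ m, ∀ s ∈ Ioc (0 : ℝ) 1, ‖S s (w κ)‖ ≤ m) :
    DifferentiableOn ℂ (fun κ => smoothVector S (lam κ) (u κ) (w κ)) U := by
  intro κ₀ hκ₀
  refine DifferentiableAt.differentiableWithinAt ?_
  obtain ⟨R, hR, hRU⟩ := Metric.nhds_basis_closedBall.mem_iff.1 (hU.mem_nhds hκ₀)
  obtain ⟨Λ, hΛ⟩ := (isCompact_closedBall κ₀ R).exists_bound_of_continuousOn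
    (hlam.continuousOn.mono hRU)
  obtain ⟨W, hW⟩ := (isCompact_closedBall κ₀ R).exists_bound_of_continuousOn
    (hw.continuousOn.mono hRU)
  set ρ := R / 2 with hρ
  have hρ0 : 0 < ρ := by positivity
  have hsub : ball κ₀ (2 * ρ) ⊆ closedBall κ₀ R := by
    rw [hρ, mul_div_cancel₀ _ two_ne_zero]; exact ball_subset_closedBall
  have hsubU := hsub.trans hRU
  set F : ℝ → ℂ → V := fun s κ => Complex.exp (-lam κ * s) • S s (w κ) with hF
  have hFd : ∀ s, DifferentiableOn ℂ (F s) U := fun s =>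
    ((hlam.neg.mul_const _).cexp).smul ((S s).differentiable.comp_differentiableOn hw)
  -- The Hartogs bound: (S1) supplies the locally uniform power bound and `hb` the bound for each
  -- parameter.
  obtain ⟨M, hM⟩ : ∃ M, ∀ s ∈ Ioc (0 : ℝ) 1, ∀ z ∈ ball κ₀ ρ, ‖F s z‖ ≤ M * s ^ (-(1 / 2) : ℝ) := by
    refine exists_bound_rpow_of_pointwise_bound (K := Real.exp Λ * (K * W)) hρ0 hα
      (fun s _ => (hFd s).mono hsubU) (fun s hs z hz => ?_) fun z hz => ?_
    · have hs0 := hs.1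
      calc ‖F s z‖ = ‖Complex.exp (-lam z * s)‖ * ‖S s (w z)‖ := norm_smul _ _
        _ ≤ Real.exp Λ * (K * s ^ (-α) * W) := by
          gcongr
          · refine (norm_exp_neg_mul_le _ hs.1.le hs.2).trans (Real.exp_le_exp.2 ?_)
            rw [mul_one]; exact hΛ z (hsub hz)
          · exact ((S s).le_of_opNorm_le (hS s hs).1 _).trans
              (by gcongr; exact hW z (hsub hz))
        _ = _ := by ring
    · obtain ⟨m, hm⟩ := hb z (hsubU hz)
      refine ⟨Real.exp (‖lam z‖ * 1) * m, fun s hs => ?_⟩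
      rw [hF]
      simp only [norm_smul]
      gcongr
      · exact norm_exp_neg_mul_le _ hs.1.le hs.2
      · exact hm s hs
  have hballU : ball κ₀ ρ ⊆ U := (ball_subset_ball (by linarith)).trans hsubU
  have hSc := continuousOn_smoothing hι hT hTd fun s hs => (hS s hs).2
  have hFc : ∀ κ, ContinuousOn (fun s => F s κ) (Ioc 0 1) := fun κ =>
    ContinuousOn.fun_smul (by fun_prop) (hSc _)
  -- Serves only to show that the κ-derivative at κ₀ is measurable in s.
  have hderiv : ∀ s, deriv (F s) κ₀ = Complex.exp (-lam κ₀ * s) • S s (deriv w κ₀) +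
      (Complex.exp (-lam κ₀ * s) * (-deriv lam κ₀ * s)) • S s (w κ₀) := by
    intro s
    have h1 := (hlam.differentiableAt (hU.mem_nhds hκ₀)).hasDerivAt
    have h2 := (hw.differentiableAt (hU.mem_nhds hκ₀)).hasDerivAt
    exact ((h1.neg.mul_const (s : ℂ)).cexp.smul ((S s).hasFDerivAt.comp_hasDerivAt κ₀ h2)).deriv
  have hrpow : IntervalIntegrable (fun s : ℝ => s ^ (-(1 / 2) : ℝ)) MeasureTheory.volume 0 1 :=
    intervalIntegral.intervalIntegrable_rpow' (by norm_num)
  have hmeas : ∀ κ, MeasureTheory.AEStronglyMeasurable (fun s => F s κ)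
      (MeasureTheory.volume.restrict (uIoc 0 1)) := fun κ => by
    rw [uIoc_of_le zero_le_one]
    exact (hFc κ).aestronglyMeasurable measurableSet_Ioc
  -- The dominating function for the derivatives is Cauchy's estimate on circles of radius ρ / 2,
  -- which stay inside the disc where the Hartogs bound holds.
  have hmain := intervalIntegral.hasDerivAt_integral_of_dominated_loc_of_deriv_le (𝕜 := ℂ)
    (μ := MeasureTheory.volume) (a := 0) (b := 1) (F := fun κ s => F s κ)
    (F' := fun κ s => deriv (F s) κ) (x₀ := κ₀) (s := ball κ₀ (ρ / 2))
    (bound := fun s => M / (ρ / 2) * s ^ (-(1 / 2) : ℝ)) (ball_mem_nhds _ (by positivity))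
    (Eventually.of_forall hmeas) ?_ ?_ ?_ (hrpow.const_mul _) ?_
  · have h1 := (hlam.differentiableAt (hU.mem_nhds hκ₀))
    have h2 := (hu.differentiableAt (hU.mem_nhds hκ₀))
    exact (h1.neg.cexp.smul ((S 1).differentiableAt.comp κ₀ h2)).add hmain.2.differentiableAt
  · refine (hrpow.const_mul M).mono_fun' (hmeas κ₀) ?_
    rw [uIoc_of_le zero_le_one]
    exact (MeasureTheory.ae_restrict_iff' measurableSet_Ioc).2
      (Eventually.of_forall fun s hs => hM s hs _ (mem_ball_self hρ0))
  · rw [uIoc_of_le zero_le_one]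
    refine ContinuousOn.aestronglyMeasurable ?_ measurableSet_Ioc
    simp only [hderiv]
    exact (ContinuousOn.fun_smul (by fun_prop) (hSc _)).add
      (ContinuousOn.fun_smul (by fun_prop) (hSc _))
  · refine Eventually.of_forall fun s hs κ hκ => ?_
    rw [uIoc_of_le zero_le_one] at hs
    have hb' : ball κ (ρ / 2) ⊆ ball κ₀ ρ :=
      ball_subset_ball' (by linarith [mem_ball.1 hκ])
    have := Complex.norm_deriv_le_of_forall_mem_sphere_norm_le (f := F s) (c := κ) (R := ρ / 2)
      (C := M * s ^ (-(1 / 2) : ℝ)) (by positivity) ?_ ?_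
    · calc _ ≤ _ := this
        _ = _ := by ring
    · refine ⟨(hFd s).mono (hb'.trans hballU), ?_⟩
      refine (hFd s).continuousOn.mono ?_
      rw [closure_ball _ (by positivity)]
      refine (closedBall_subset_ball' ?_ : closedBall κ (ρ / 2) ⊆ ball κ₀ ρ).trans hballU
      linarith [mem_ball.1 hκ]
    · intro z hz
      refine hM s hs z (closedBall_subset_ball' ?_ (sphere_subset_closedBall hz))
      linarith [mem_ball.1 hκ]
  · refine Eventually.of_forall fun s hs κ hκ => ?_
    refine ((hFd s).differentiableAt (hU.mem_nhds (hballU ?_))).hasDerivAt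
    exact ball_subset_ball (by linarith) hκ

end Embedded

/-! ### Perturbations that are bounded on the domain -/

section RelativelyBounded

variable {X : Type*} [NormedAddCommGroup X] [NormedSpace ℂ X] {A B : X →ₗ.[ℂ] X} {z₀ : ℂ}
  {C : X →L[ℂ] X}

/-- C = B R(z₀, A), which is bounded because the resolvent maps X boundedly into dom(A) with the
graph norm. -/
theorem exists_clm_of_isBoundedOnDomain (hz₀ : z₀ ∈ resolventSet A) (hB : IsBoundedOnDomain A B) :
    ∃ C : X →L[ℂ] X, ∀ x a, (x, a) ∈ A.graph → val B x = C (z₀ • x - a) := by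
  obtain ⟨R, hR⟩ := hz₀
  obtain ⟨hdom, M, hM⟩ := hB
  have hRB : ∀ y, R y ∈ B.domain := fun y => hdom ▸ (hR.1 y).1
  let L : X →ₗ[ℂ] X := B.toFun ∘ₗ R.toLinearMap.codRestrict B.domain hRB
  have hbound : ∀ y, ‖L y‖ ≤ |M| * (‖R‖ + (‖z₀‖ * ‖R‖ + 1)) * ‖y‖ := by
    intro y
    obtain ⟨h, hy⟩ := hR.1 y
    have h1 : A ⟨R y, h⟩ = z₀ • R y - y := by
      rw [eq_sub_iff_add_eq, add_comm]; exact (sub_eq_iff_eq_add.1 hy).symm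
    have h2 : ‖z₀ • R y - y‖ ≤ ‖z₀‖ * (‖R‖ * ‖y‖) + ‖y‖ := by
      refine (norm_sub_le _ _).trans ?_
      rw [norm_smul]
      gcongr
      exact R.le_opNorm y
    calc ‖L y‖ ≤ M * (‖R y‖ + ‖A ⟨R y, h⟩‖) := hM _ h (hRB y)
      _ ≤ |M| * (‖R‖ * ‖y‖ + (‖z₀‖ * (‖R‖ * ‖y‖) + ‖y‖)) := by
        rw [h1]
        gcongr
        · exact le_abs_self M
        · exact R.le_opNorm y
      _ = _ := by ring
  refine ⟨L.mkContinuous _ hbound, fun x a hx => ?_⟩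
  have h1 : R (z₀ • x - a) = x := hR.mem_graph_iff.1 hx
  have h2 : val B x = val B (R (z₀ • x - a)) := by rw [h1]
  rw [h2, val, dif_pos (hRB _)]
  rfl

theorem isPerturbedBy_add (hdom : B.domain = A.domain)
    (hB : ∀ x a, (x, a) ∈ A.graph → val B x = C (z₀ • x - a)) : IsPerturbedBy A (A + B) z₀ C := by
  intro x y
  constructor
  · intro h
    obtain ⟨h1, rfl⟩ := mk_mem_graph_iff.1 h
    obtain ⟨hxA, hxB⟩ : x ∈ A.domain ∧ x ∈ B.domain := h1
    have h2 : (x, A ⟨x, hxA⟩) ∈ A.graph := mk_mem_graph_iff.2 ⟨hxA, rfl⟩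
    refine ⟨_, h2, ?_⟩
    rw [← hB _ _ h2, val, dif_pos hxB]
    rfl
  · rintro ⟨a, ha, rfl⟩
    obtain ⟨h1, rfl⟩ := mk_mem_graph_iff.1 ha
    have h2 : x ∈ B.domain := hdom ▸ h1
    refine mk_mem_graph_iff.2 ⟨⟨h1, h2⟩, ?_⟩
    rw [← hB _ _ ha, val, dif_pos h2]
    rfl

end RelativelyBounded

/-- Holomorphic families of relatively bounded perturbations correspond to norm holomorphic
families of bounded operators. -/
theorem exists_differentiableOn_isPerturbedBy {X : Type*} [NormedAddCommGroup X] [NormedSpace ℂ X]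
    [CompleteSpace X] {A : X →ₗ.[ℂ] X} {z₀ : ℂ} (hz₀ : z₀ ∈ resolventSet A) {B : ℂ → X →ₗ.[ℂ] X}
    {U : Set ℂ} (hU : IsOpen U) (hB : ∀ κ ∈ U, IsBoundedOnDomain A (B κ))
    (hol : ∀ x ∈ A.domain, DifferentiableOn ℂ (fun κ => val (A + B κ) x) U) :
    ∃ C : ℂ → X →L[ℂ] X, DifferentiableOn ℂ C U ∧
      ∀ κ ∈ U, (∀ x a, (x, a) ∈ A.graph → val (B κ) x = C κ (z₀ • x - a)) ∧
        IsPerturbedBy A (A + B κ) z₀ (C κ) := by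
  have h : ∀ κ, ∃ C : X →L[ℂ] X, κ ∈ U →
      ∀ x a, (x, a) ∈ A.graph → val (B κ) x = C (z₀ • x - a) := by
    intro κ
    by_cases hκ : κ ∈ U
    · obtain ⟨C, hC⟩ := exists_clm_of_isBoundedOnDomain hz₀ (hB κ hκ)
      exact ⟨C, fun _ => hC⟩
    · exact ⟨0, fun h => absurd h hκ⟩
  choose C hC using h
  have hp : ∀ κ ∈ U, IsPerturbedBy A (A + B κ) z₀ (C κ) := fun κ hκ =>
    isPerturbedBy_add (hB κ hκ).1 (hC κ hκ)
  refine ⟨C, differentiableOn_of_forall_apply hU fun y => ?_, fun κ hκ => ⟨hC κ hκ, hp κ hκ⟩⟩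
  obtain ⟨R, hR⟩ := hz₀
  -- C(κ)y = (A + B(κ))Ry - ARy, so only orbits of vectors in dom(A) enter and strong holomorphy is
  -- inherited.
  have hg : (R y, z₀ • R y - y) ∈ A.graph := (isResolventAt_iff.1 hR).1 y
  refine ((hol _ (LinearPMap.mem_domain_of_mem_graph hg)).sub_const (z₀ • R y - y)).congr
    fun κ hκ => ?_
  have h1 := val_eq_of_mem_graph ((hp κ hκ _ _).2 ⟨_, hg, rfl⟩)
  rw [sub_sub_cancel] at h1
  rw [h1, add_sub_cancel_left]

end AnalyticPerturbation

open AnalyticPerturbation in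
theorem mainTheorem3
    {X V : Type*} [NormedAddCommGroup X] [NormedSpace ℂ X] [CompleteSpace X]
    [NormedAddCommGroup V] [NormedSpace ℂ V] [CompleteSpace V]
    -- the continuous embedding of `V` into `X`, with (B1) or (B2)
    (ι : V →L[ℂ] X) (hι : Function.Injective ι)
    (hV : TopologicalSpace.SeparableSpace V ∨ IsClosed (ι '' closedBall (0 : V) 1))
    -- the immediately differentiable semigroup and its generator
    (T : ℝ → X →L[ℂ] X) (hT : IsC0Semigroup T) (hTd : IsImmediatelyDifferentiable T)
    (A : X →ₗ.[ℂ] X) (hA : IsGenerator T A)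
    -- the perturbations; (S1) does not involve `κ`, the constants in (S2), (S3) may depend on `κ`
    (B : ℂ → X →ₗ.[ℂ] X)
    (hB : ∀ κ ∈ ball (0 : ℂ) 1, IsBoundedOnDomain A (B κ))
    (hB0 : ∀ x : (B 0).domain, B 0 x = 0)
    (hS1 : CondS1 ι T)
    (hS2 : ∀ κ ∈ ball (0 : ℂ) 1, CondS2 T A (B κ))
    (hS3 : ∀ κ ∈ ball (0 : ℂ) 1, CondS3 ι T (B κ))
    (hol : ∀ x ∈ A.domain, DifferentiableOn ℂ (fun κ => val (A + B κ) x) (ball 0 1))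
    -- the unperturbed eigenvalue
    (lam₀ : ℂ) (hpole : IsResolventPole A lam₀) (hsimple : IsAlgSimple A lam₀)
    (r : ℝ) (hr : 0 < r) (hiso : closedBall lam₀ r ∩ spec A = {lam₀})
    (hβ : Tendsto (fun κ => relSup A (B κ) lam₀ r) (𝓝[≠] 0) (𝓝 0)) :
    ∃ δ : ℝ, 0 < δ ∧ δ ≤ 1 ∧
      ∃ (lam : ℂ → ℂ) (P : ℂ → X →L[ℂ] X) (PV : ℂ → V →L[ℂ] V),
        (∀ κ ∈ ball (0 : ℂ) δ,
          spec (A + B κ) ∩ ball lam₀ r = {lam κ} ∧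
          IsResolventPole (A + B κ) (lam κ) ∧
          IsAlgSimple (A + B κ) (lam κ) ∧
          IsSpectralProjection (A + B κ) (lam κ) (P κ) ∧
          range (P κ) ⊆ range ι ∧
          -- `PV κ` is `P κ` as an operator on `V`
          ∀ v : V, ι (PV κ v) = P κ (ι v)) ∧
        AnalyticOnNhd ℂ lam (ball 0 δ) ∧
        AnalyticOnNhd ℂ P (ball 0 δ) ∧
        AnalyticOnNhd ℂ PV (ball 0 δ) := by
  obtain ⟨e, φ, H, hD⟩ := exists_isSimplePoleDecomposition hpole hsimple hiso
  obtain ⟨z₀, hz₀⟩ := hpole.2.1.exists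
  obtain ⟨C, hC, hCB⟩ := exists_differentiableOn_isPerturbedBy hz₀ isOpen_ball hB hol
  obtain ⟨S, K, α, hK, hα, hS⟩ := exists_smoothing hι hS1
  have hSι : ∀ s ∈ Ioc (0 : ℝ) 1, ∀ x, ι (S s x) = T s x := fun s hs => (hS s hs).2
  have hC0 : C 0 = 0 := by
    have h0 : (0 : ℂ) ∈ ball (0 : ℂ) 1 := mem_ball_self one_pos
    obtain ⟨R, hR⟩ := hz₀
    ext y
    have h1 := (hCB 0 h0).1 _ _ ((isResolventAt_iff.1 hR).1 y)
    rw [sub_sub_cancel] at h1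
    rw [← h1, val]
    split_ifs with h
    · exact hB0 _
    · rfl
  obtain ⟨ε, hε, hsmall⟩ := exists_isSmallPerturbation hD z₀ hr
  -- Smallness of the perturbation comes from norm continuity of C at 0, where C vanishes.
  obtain ⟨δ, hδ, hδ1, hδε⟩ : ∃ δ : ℝ, 0 < δ ∧ δ ≤ 1 ∧ ∀ κ ∈ ball (0 : ℂ) δ, ‖C κ‖ < ε := by
    have h1 : ContinuousAt C 0 := hC.continuousOn.continuousAt (ball_mem_nhds _ one_pos)
    obtain ⟨δ, hδ, h⟩ := Metric.continuousAt_iff.1 h1 ε hε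
    refine ⟨min δ 1, lt_min hδ one_pos, min_le_right _ _, fun κ hκ => ?_⟩
    have := h (lt_of_lt_of_le hκ (min_le_left _ _))
    rwa [hC0, dist_zero_right] at this
  have hsub : ball (0 : ℂ) δ ⊆ ball 0 1 := ball_subset_ball hδ1
  replace hsmall := fun κ hκ => hsmall (C κ) (hδε κ hκ)
  have hCδ := hC.mono hsub
  obtain ⟨lam, hlam, hlam0⟩ := exists_differentiableOn_zero_charFun hD hr isOpen_ball hCδ hsmall
  set u : ℂ → X := fun κ => reducedVector z₀ lam₀ e φ H (C κ) (lam κ) with hu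
  set w : ℂ → X := fun κ => reducedSource z₀ lam₀ e φ H (C κ) (lam κ) with hw
  set ψ : ℂ → X →L[ℂ] ℂ := fun κ => reducedFunctional z₀ lam₀ e φ H (C κ) (lam κ) with hψ
  set v : ℂ → V := fun κ => smoothVector S (lam κ) (u κ) (w κ) with hv
  have hclosed : ∀ κ ∈ ball (0 : ℂ) δ, lam κ ∈ closedBall lam₀ r := fun κ hκ =>
    ball_subset_closedBall (hlam0 κ hκ).1
  have hgraph : ∀ κ ∈ ball (0 : ℂ) δ, (u κ, lam κ • u κ - w κ) ∈ A.graph := fun κ hκ =>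
    reducedVector_mem_graph_unperturbed hD (hclosed κ hκ) (hlam0 κ hκ).2
  -- No uniformity in κ is claimed, since the constants of (S2) and (S3) may vary with κ.
  have hbdd : ∀ κ ∈ ball (0 : ℂ) δ, ∃ m, ∀ s ∈ Ioc (0 : ℝ) 1, ‖S s (w κ)‖ ≤ m := by
    intro κ hκ
    have hκ1 := hsub hκ
    refine exists_bound_smoothing hι (hS3 κ hκ1) hSι ?_
    exact source_mem_range hι hT hTd hA (hB κ hκ1).1 (hCB κ hκ1).1 (hS2 κ hκ1) (hS3 κ hκ1) hSι
      (hgraph κ hκ)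
      (reducedSource_eq ((hsmall κ hκ).isUnit _ (hclosed κ hκ)) (hlam0 κ hκ).2)
  have hvu : ∀ κ ∈ ball (0 : ℂ) δ, ι (v κ) = u κ := fun κ hκ =>
    map_smoothVector hι hT hTd hA hSι (hgraph κ hκ) (hbdd κ hκ)
  have hud : DifferentiableOn ℂ u (ball 0 δ) := fun κ hκ =>
    (differentiableAt_reducedVector hD (hCδ.differentiableAt (isOpen_ball.mem_nhds hκ))
      (hlam.differentiableAt (isOpen_ball.mem_nhds hκ)) (hclosed κ hκ)
      ((hsmall κ hκ).isUnit _ (hclosed κ hκ))).differentiableWithinAt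
  have hwd : DifferentiableOn ℂ w (ball 0 δ) := fun κ hκ =>
    (differentiableAt_reducedSource hD (hCδ.differentiableAt (isOpen_ball.mem_nhds hκ))
      (hlam.differentiableAt (isOpen_ball.mem_nhds hκ)) (hclosed κ hκ)
      ((hsmall κ hκ).isUnit _ (hclosed κ hκ))).differentiableWithinAt
  have hψd : DifferentiableOn ℂ ψ (ball 0 δ) := fun κ hκ =>
    (differentiableAt_reducedFunctional hD (hCδ.differentiableAt (isOpen_ball.mem_nhds hκ))
      (hlam.differentiableAt (isOpen_ball.mem_nhds hκ)) (hclosed κ hκ)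
      ((hsmall κ hκ).isUnit _ (hclosed κ hκ))
      ((hsmall κ hκ).ne_zero _ (hclosed κ hκ) _ (hclosed κ hκ))).differentiableWithinAt
  have hvd : DifferentiableOn ℂ v (ball 0 δ) :=
    differentiableOn_smoothVector hι hT hTd hK hα hS isOpen_ball hlam hud hwd hbdd
  -- P = ψ(·)u has rank one with u = ι v, so its restriction to V is ψ(ι ·)v, and only v requires
  -- holomorphy in the norm of V.
  refine ⟨δ, hδ, hδ1, lam, fun κ => (ψ κ).smulRight (u κ),
    fun κ => ((ψ κ).comp ι).smulRight (v κ), fun κ hκ => ?_, hlam.analyticOnNhd isOpen_ball,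
    DifferentiableOn.analyticOnNhd ?_ isOpen_ball, DifferentiableOn.analyticOnNhd ?_ isOpen_ball⟩
  · have hP := (hCB κ (hsub hκ)).2
    have hs := hsmall κ hκ
    obtain ⟨hl, hl0⟩ := hlam0 κ hκ
    have hlc := hclosed κ hκ
    have hne : ∀ z ∈ closedBall lam₀ r, z ≠ lam κ → charFun z₀ lam₀ e φ H (C κ) z ≠ 0 := by
      intro z hz hzl
      rw [charFun_eq_mul hD hP hlc (hs.isUnit _ hlc) hl0 hz (hs.isUnit z hz)]
      exact mul_ne_zero (sub_ne_zero.2 hzl) (hs.ne_zero z hz _ hlc)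
    refine ⟨?_, isResolventPole_perturbed hD hP hs.isUnit hl hl0 hne,
      isAlgSimple_perturbed hD hP hlc (hs.isUnit _ hlc) hl0 (hs.ne_zero _ hlc _ hlc),
      isSpectralProjection_perturbed hD hP hs.isUnit hl hl0 fun z hz => hs.ne_zero z hz _ hlc,
      ?_, fun x => ?_⟩
    · ext z
      refine ⟨fun ⟨hz, hzr⟩ => ?_, ?_⟩
      · have hzc := ball_subset_closedBall hzr
        by_contra hzl
        exact hne z hzc hzl ((mem_spec_perturbed_iff hD hP hzc (hs.isUnit z hzc)).1 hz)
      · rintro rfl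
        exact ⟨(mem_spec_perturbed_iff hD hP hlc (hs.isUnit _ hlc)).2 hl0, hl⟩
    · rintro _ ⟨x, rfl⟩
      exact ⟨ψ κ x • v κ, by rw [map_smul, hvu κ hκ]; rfl⟩
    · simp [hvu κ hκ]
  · exact fun κ hκ => ((ContinuousLinearMap.smulRightL ℂ X X).differentiableAt.comp_differentiableWithinAt
      κ (hψd κ hκ)).clm_apply (hud κ hκ)
  · exact fun κ hκ => ((ContinuousLinearMap.smulRightL ℂ V V).differentiableAt.comp_differentiableWithinAt
      κ ((hψd κ hκ).clm_comp (differentiableWithinAt_const ι))).clm_apply (hvd κ hκ)
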